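/- **Setting.** Let $G=(V,W,E)$, $E\subseteq V\times W$, be a finite bipartite graph with a nonempty set $V$ of $N$ servers and a nonempty set $W$ of $M$ task types (dispatchers). For $w\in W$ let $\mathcal N_w=\{v\in V:(v,w)\in E\}$ and $d_w=|\mathcal N_w|$, where $d_w\ge 1$ for every $w$; for $v\in V$ let $\mathcal N_v=\{w\in W:(v,w)\in E\}$. Let $\lambda>0$ and let $d\ge 2$ be an integer. Tasks of each type $w\in W$ arrive according to independent Poisson processes of rate $\lambda N/M$. When a task of type $w$ arrives, $d$ servers are sampled uniformly with replacement from $\mathcal N_w$, and the task joins the shortest queue among the sampled servers, ties being broken uniformly at random. Service times are independent and exponential with mean $1$, and each server handles the tasks in its queue one at a time. The queue lengths $\boldsymbol X(t)=(X_v(t))_{v\in V}\in\{0,1,2,\dots\}^V$ form a continuous-time Markov chain. Write $q_i(t)=\frac1N\,|\{v\in V: X_v(t)\ge i\}|$ for $i\ge 1$ and $$\rho(G)=\max_{v\in V}\frac{\lambda N}{M}\sum_{w\in\mathcal N_v}\frac1{d_w}.$$ For random vectors, $\boldsymbol X\le_{st}\boldsymbol Y$ means that copies of $\boldsymbol X$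 and $\boldsymbol Y$ can be defined on a common probability space so that almost surely $X_v\le Y_v$ for all $v$. **Theorem.** For every $\rho_0<1$ and every integer $d\ge 2$ there exist constants $c_1,c_2>0$ and $0<\alpha\le 1$, depending only on $\rho_0$ and $d$, such that the following holds for all $G$ and $\lambda$ as above with $\rho(G)\le\rho_0$. Let $\boldsymbol X(\infty)$ have the stationary distribution of the Markov chain $\boldsymbol X(t)$, and let $\boldsymbol X_0$ be a random vector in $\{0,1,2,\dots\}^V$ with $\boldsymbol X_0\le_{st}\boldsymbol X(\infty)$. Then there is a probability space carrying two copies $\boldsymbol X^{(1)}(t)$ and $\boldsymbol X^{(2)}(t)$, $t\ge 0$, of the Markov chain on $G$, with $\boldsymbol X^{(1)}(0)\overset{d}{=}\boldsymbol X_0$ and $\boldsymbol X^{(2)}(0)\overset{d}{=}\boldsymbol X(\infty)$, such that for all $t\ge 0$ $$\sum_{i=1}^\infty \mathbb E\Big[\big|q_i^{(2)}(t)-q_i^{(1)}(t)\big|\Big]\le\frac1{(c_1+c_2t)^{\alpha}},$$ where $q_i^{(k)}(t)$ is the fraction of servers with queue length at least $i$ in system $k$. -/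

import Mathlib

open Finset MeasureTheory Filter Topology
open scoped NNReal

namespace JSQ

/-- A queue-length configuration: `x v` is the number of tasks at server `v`. -/
abbrev State (V : Type) : Type := V → ℕ

section Model

variable {V W : Type} [Fintype V] [DecidableEq V] [Fintype W] [DecidableEq W]

/-- `N_w`: the servers compatible with the task type (dispatcher) `w`, for the bipartite graph
with edge set `E ⊆ V × W`. -/
def serversOf (E : Finset (V × W)) (w : W) : Finset V := {v | (v, w) ∈ E}

/-- `N_v`: the task types compatible with the server `v`. -/
def typesOf (E : Finset (V × W)) (v : V) : Finset W := {w | (v, w) ∈ E}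

/-- `ρ(G) = max_v (λ N / M) ∑_{w ∈ N_v} 1 / d_w`, where `N = |V|`, `M = |W|`, `d_w = |N_w|`. -/
noncomputable def maxLoad [Nonempty V] (E : Finset (V × W)) (lam : ℝ) : ℝ :=
  univ.sup' univ_nonempty fun v : V =>
    lam * (Fintype.card V : ℝ) / (Fintype.card W : ℝ) *
      ∑ w ∈ typesOf E v, 1 / (#(serversOf E w) : ℝ)

/-- The set of those servers among the sampled ones `s 0, …, s (d - 1)` whose queue is shortest. -/
def shortest {E : Finset (V × W)} {d : ℕ} {w : W} (x : State V)
    (s : Fin d → serversOf E w) : Finset V :=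
  {v ∈ univ.image (fun j => (s j : V)) | ∀ j, x v ≤ x (s j)}

/-- The probability that JSQ(`d`) sends a task arriving at dispatcher `w` to server `v` when the
queue lengths are `x`: `d` servers are drawn uniformly with replacement from `N_w` (each of the
`d_w ^ d` samples `s` is equally likely), and the task joins a uniformly chosen one of the
shortest queues in the sample. -/
noncomputable def assignProb (E : Finset (V × W)) (d : ℕ) (x : State V) (w : W) (v : V) : ℝ :=
  (∑ s : Fin d → serversOf E w, if v ∈ shortest x s then 1 / (#(shortest x s) : ℝ) else 0) /
    (#(serversOf E w) : ℝ) ^ d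

/-- The generator of the queue-length process: each dispatcher receives tasks at rate `λ N / M`,
routed by JSQ(`d`), and each server with a nonempty queue completes tasks at rate `1`. -/
noncomputable def generator (E : Finset (V × W)) (d : ℕ) (lam : ℝ) (f : State V → ℝ) :
    State V → ℝ := fun x =>
  (∑ w : W, lam * (Fintype.card V : ℝ) / (Fintype.card W : ℝ) *
      ∑ v : V, assignProb E d x w v * (f (Function.update x v (x v + 1)) - f x)) +
    ∑ v : V, if 0 < x v then f (Function.update x v (x v - 1)) - f x else 0

/-- The transition function `p_t(x, y) = (e^{t L} 1_y)(x)` generated by the generator `L`.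
The jump rates are bounded, so the exponential series converges absolutely. -/
noncomputable def transition (E : Finset (V × W)) (d : ℕ) (lam : ℝ) (t : ℝ) (x y : State V) : ℝ :=
  ∑' n : ℕ, t ^ n / (n.factorial : ℝ) *
    ((generator E d lam)^[n] (fun z => if z = y then 1 else 0)) x

/-- `X` is a queue-length process on `(Ω, P)` with initial law `μ`: a Markov process with
transition function `transition` (given by its finite-dimensional distributions) whose paths are
almost surely right-continuous with left limits. -/
structure IsQueueProcess (E : Finset (V × W)) (d : ℕ) (lam : ℝ) (μ : Measure (State V))
    {Ω : Type} [MeasurableSpace Ω] (P : Measure Ω) (X : ℝ≥0 → Ω → State V) : Prop where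
  measurable : ∀ t, Measurable (X t)
  cadlag : ∀ᵐ ω ∂P, ∀ t : ℝ≥0, ContinuousWithinAt (fun s => X s ω) (Set.Ici t) t ∧
    ∃ y : State V, Tendsto (fun s => X s ω) (𝓝[<] t) (𝓝 y)
  finite_dim : ∀ (n : ℕ) (t : Fin (n + 1) → ℝ≥0) (x : Fin (n + 1) → State V),
    Monotone t → t 0 = 0 →
      P.real {ω | ∀ i, X (t i) ω = x i} =
        μ.real {x 0} * ∏ i : Fin n,
          transition E d lam ((t i.succ : ℝ) - (t i.castSucc : ℝ)) (x i.castSucc) (x i.succ)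

/-- `π` is a steady-state law of the queue-length process: `π p_t = π` for all `t ≥ 0`. -/
def IsStationary (E : Finset (V × W)) (d : ℕ) (lam : ℝ) (π : Measure (State V)) : Prop :=
  ∀ (t : ℝ≥0) (y : State V),
    HasSum (fun x => π.real {x} * transition E d lam t x y) (π.real {y})

/-- Stochastic ordering of two laws: random vectors with these laws can be put on a common
probability space such that one is almost surely coordinatewise at most the other. -/
def StochLE (μ ν : Measure (State V)) : Prop :=
  ∃ (Ω : Type) (_ : MeasurableSpace Ω) (P : Measure Ω) (_ : IsProbabilityMeasure P)
    (X Y : Ω → State V), Measurable X ∧ Measurable Y ∧ P.map X = μ ∧ P.map Y = ν ∧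
      ∀ᵐ ω ∂P, ∀ v, X ω v ≤ Y ω v

/-- `q_i(x)`: the fraction of servers whose queue length is at least `i`. -/
noncomputable def tailFrac (x : State V) (i : ℕ) : ℝ :=
  (#{v : V | i ≤ x v} : ℝ) / (Fintype.card V : ℝ)

end Model

end JSQ

/-! The process is uniformized: events occur at total rate `r = totalRate V lam`, and each carries a
mark that is either an arrival (dispatcher, sample of servers, tie-breaking ranking) or a potential
departure. Both copies start from an ordered pair and see the same events. The event map is monotone
(`queueStep_mono`), so the order persists and the sum of the differences of the `q_i` is `excess /
N`, the normalized number of surplus tasks in the larger system (`tsum_abs_tailFrac_sub`).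

Arrivals leave the excess unchanged. It falls only at a departure from a server that is empty in the
smaller system and busy in the larger one. To turn this into a drift, a small bonus is subtracted:
`gapFunction` is the excess minus `b` times the sum of `b ^ x_v` over servers with `x_v < y_v`. A
departure with `x_v > 0` raises the bonus, and arrivals can destroy it at rate at most `d * ρ` per
unit, so for small `b` the drift is at most minus half the sum of the gap weights
(`stepOp_gapFunction_le`).

The gap weights are tiny at long queues and do not control the excess linearly. Exponential moments
make long queues rare: JSQ does no worse for them than uniform routing, so the stationary law has a
moment of order `N`, uniformly in the graph (`stepOp_expSum_le`, `lintegral_stationary_le`).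
Interpolation (`excess_le_interpolation`) then gives, for every `ε` in `(0, 1]`, a decay `u' ≤ -(ε ^
m / 2) (u - ε C)` of the normalized mean `u`. Choosing `ε` proportional to `u` yields `u' ≤ -c u ^
(m + 1)`, hence decay like `t ^ (-1 / m)` (`poissonMixture_le`).

All of this concerns the embedded discrete chain. Since means at time `t` are Poisson mixtures of
its iterates (`lintegral_flow`), the estimates pass to continuous time without dependence on `r`.
Identifying the construction with the given transition function rests on `generator = r (K - 1)`,
where `K` is the one-step operator (`generator_eq`, `transition_eq`). -/

namespace JSQ

open ProbabilityTheory
open scoped ENNReal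

set_option linter.unusedSectionVars false

/-! ### Exponential waiting times and Poisson weights. -/

section ExponentialClock

/-- The Poisson probabilities `e^{-rt} (rt)^k / k!`. -/
noncomputable def poissonWeight (r t : ℝ) (k : ℕ) : ℝ :=
  Real.exp (-(r * t)) * ((r * t) ^ k / (k.factorial : ℝ))

lemma poissonWeight_nonneg {r t : ℝ} (hr : 0 ≤ r) (ht : 0 ≤ t) (k : ℕ) :
    0 ≤ poissonWeight r t k := by
  unfold poissonWeight; positivity

lemma hasSum_poissonWeight (r t : ℝ) : HasSum (poissonWeight r t) 1 := by
  have h : HasSum (fun n : ℕ => (r * t) ^ n / (n.factorial : ℝ)) (Real.exp (r * t)) := by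
    rw [Real.exp_eq_exp_ℝ]
    exact NormedSpace.expSeries_div_hasSum_exp (r * t)
  have h2 := h.mul_left (Real.exp (-(r * t)))
  rwa [← Real.exp_add, neg_add_cancel, Real.exp_zero] at h2

lemma lintegral_expMeasure (r : ℝ) {g : ℝ → ℝ≥0∞} (hg : Measurable g) :
    ∫⁻ T, g T ∂(expMeasure r) = ∫⁻ T, exponentialPDF r T * g T := by
  have hm : Measurable (exponentialPDF r) :=
    (measurable_exponentialPDFReal r).ennreal_ofReal
  exact lintegral_withDensity_eq_lintegral_mul _ hm hg

lemma lintegral_expMeasure_memoryless (r : ℝ) {s : ℝ} (hs : 0 ≤ s) {g : ℝ → ℝ≥0∞}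
    (hg : Measurable g) :
    ∫⁻ T, (if s < T then g (T - s) else 0) ∂(expMeasure r)
      = ENNReal.ofReal (Real.exp (-(r * s))) * ∫⁻ T, g T ∂(expMeasure r) := by
  have hm : Measurable (exponentialPDF r) :=
    (measurable_exponentialPDFReal r).ennreal_ofReal
  have hm' : Measurable fun T => if s < T then g (T - s) else 0 :=
    Measurable.ite measurableSet_Ioi (hg.comp (measurable_id.sub_const s)) measurable_const
  rw [lintegral_expMeasure r hg, lintegral_expMeasure r hm',
    ← lintegral_const_mul _ (show Measurable fun T => exponentialPDF r T * g T from hm.mul hg),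
    ← lintegral_add_right_eq_self _ s]
  -- At `T = 0` the strict inequality fails although the density is positive, so this null set is
  -- discarded.
  have h0 : ∀ᵐ T : ℝ, T ≠ 0 := by simp [ae_iff]
  refine lintegral_congr_ae (h0.mono fun T hT => ?_)
  simp only [add_sub_cancel_right]
  rcases lt_or_gt_of_ne hT with h | h
  · rw [if_neg (by linarith), exponentialPDF_of_neg h]; simp
  · rw [if_pos (by linarith), exponentialPDF_of_nonneg h.le,
      exponentialPDF_of_nonneg (by linarith), ← mul_assoc,
      ← ENNReal.ofReal_mul (Real.exp_pos _).le]
    congr 2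
    rw [mul_left_comm, ← Real.exp_add]
    congr 2; ring

/-- Conditioning on the first waiting time `T`: there are `k + 1` events by time `s` when `T ≤ s`
and `k` more follow within `s - T`. This recursion drives the induction on the number of jumps. -/
lemma lintegral_expMeasure_poissonWeight {r : ℝ} (hr : 0 < r) {s : ℝ} (hs : 0 ≤ s) (k : ℕ) :
    ∫⁻ T, (if T ≤ s then ENNReal.ofReal (poissonWeight r (s - T) k) else 0) ∂(expMeasure r)
      = ENNReal.ofReal (poissonWeight r s (k + 1)) := by
  have hc : Continuous fun T => poissonWeight r (s - T) k := by
    unfold poissonWeight; fun_prop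
  rw [lintegral_expMeasure r (Measurable.ite measurableSet_Iic hc.measurable.ennreal_ofReal
    measurable_const)]
  have hpt : ∀ T : ℝ, exponentialPDF r T *
      (if T ≤ s then ENNReal.ofReal (poissonWeight r (s - T) k) else 0)
      = (Set.Icc 0 s).indicator (fun T => ENNReal.ofReal
        (r * Real.exp (-(r * s)) * ((r * (s - T)) ^ k / (k.factorial : ℝ)))) T := by
    intro T
    by_cases h0 : 0 ≤ T
    · by_cases h1 : T ≤ s
      · rw [if_pos h1, Set.indicator_of_mem (Set.mem_Icc.mpr ⟨h0, h1⟩), exponentialPDF_of_nonneg h0,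
          ← ENNReal.ofReal_mul (by positivity)]
        congr 1
        unfold poissonWeight
        have : Real.exp (-(r * s)) = Real.exp (-(r * T)) * Real.exp (-(r * (s - T))) := by
          rw [← Real.exp_add]; congr 1; ring
        rw [this]; ring
      · rw [if_neg h1, Set.indicator_of_notMem (fun h => h1 h.2), mul_zero]
    · rw [exponentialPDF_of_neg (not_le.mp h0), Set.indicator_of_notMem (fun h => h0 h.1), zero_mul]
  simp_rw [hpt]
  rw [lintegral_indicator measurableSet_Icc]
  have hc2 : Continuous fun T : ℝ =>
      r * Real.exp (-(r * s)) * ((r * (s - T)) ^ k / (k.factorial : ℝ)) := by fun_prop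
  rw [← ofReal_integral_eq_lintegral_ofReal (hc2.continuousOn.integrableOn_Icc)]
  · congr 1
    rw [integral_Icc_eq_integral_Ioc, ← intervalIntegral.integral_of_le hs]
    have hd : ∀ x ∈ Set.uIcc 0 s, HasDerivAt
        (fun T : ℝ => -(Real.exp (-(r * s)) * ((r * (s - T)) ^ (k + 1) / ((k + 1).factorial : ℝ))))
        (r * Real.exp (-(r * s)) * ((r * (s - x)) ^ k / (k.factorial : ℝ))) x := by
      intro x _
      have h1 : HasDerivAt (fun T : ℝ => r * (s - T)) (r * (-1)) x :=
        ((hasDerivAt_id x).const_sub s).const_mul r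
      convert! (((h1.pow (k + 1)).div_const ((k + 1).factorial : ℝ)).const_mul
        (Real.exp (-(r * s)))).neg using 1
      rw [Nat.factorial_succ]
      have : ((k.factorial : ℕ) : ℝ) ≠ 0 := by positivity
      push_cast
      field_simp
    rw [intervalIntegral.integral_eq_sub_of_hasDerivAt hd (hc2.intervalIntegrable _ _)]
    unfold poissonWeight
    simp
  · refine (ae_restrict_iff' measurableSet_Icc).mpr (Eventually.of_forall fun T hT => ?_)
    have : 0 ≤ s - T := by linarith [hT.2]
    simp only [Pi.zero_apply]
    positivity

end ExponentialClock

/-! ### Pathwise construction of a jump process from waiting times and marks. -/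

section JumpProcess

variable {S Ξ : Type}

/-- Drops the first waiting time and the first mark. -/
def shiftNoise (η : ℕ → ℝ × Ξ) : ℕ → ℝ × Ξ := fun n => η (n + 1)

/-- Puts a waiting time and a mark in front of a sequence. -/
def consNoise (a : ℝ × Ξ) (η : ℕ → ℝ × Ξ) : ℕ → ℝ × Ξ
  | 0 => a
  | n + 1 => η n

@[simp] lemma consNoise_zero (a : ℝ × Ξ) (η : ℕ → ℝ × Ξ) : consNoise a η 0 = a := rfl

@[simp] lemma shiftNoise_consNoise (a : ℝ × Ξ) (η : ℕ → ℝ × Ξ) :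
    shiftNoise (consNoise a η) = η := rfl

/-- Exactly `k` of the waiting times have run out by time `t`. -/
def JumpsAt : ℕ → ℝ → (ℕ → ℝ × Ξ) → Prop
  | 0, t, η => 0 ≤ t ∧ t < (η 0).1
  | k + 1, t, η => 0 ≤ t ∧ JumpsAt k (t - (η 0).1) (shiftNoise η)

/-- The state after `k` jumps from `z`. -/
def chain (step : S → Ξ → S) : ℕ → S → (ℕ → ℝ × Ξ) → S
  | 0, z, _ => z
  | k + 1, z, η => chain step k (step z (η 0).2) (shiftNoise η)

/-- The noise that is left at time `s`, if `k` jumps have occurred by then. -/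
def residualNoise : ℕ → ℝ → (ℕ → ℝ × Ξ) → (ℕ → ℝ × Ξ)
  | 0, s, η => consNoise ((η 0).1 - s, (η 0).2) (shiftNoise η)
  | k + 1, s, η => residualNoise k (s - (η 0).1) (shiftNoise η)

lemma JumpsAt.nonneg : ∀ {k : ℕ} {t : ℝ} {η : ℕ → ℝ × Ξ}, JumpsAt k t η → 0 ≤ t
  | 0, _, _, h => h.1
  | _ + 1, _, _, h => h.1

/-- Each level of `JumpsAt` demands a nonnegative remaining time, so uniqueness needs no sign
condition on the waiting times. -/
lemma JumpsAt.unique : ∀ {k l : ℕ} {t : ℝ} {η : ℕ → ℝ × Ξ},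
    JumpsAt k t η → JumpsAt l t η → k = l
  | 0, 0, _, _, _, _ => rfl
  | 0, _ + 1, _, _, h, h' => by have := h'.2.nonneg; have := h.2; linarith
  | _ + 1, 0, _, _, h, h' => by have := h.2.nonneg; have := h'.2; linarith
  | _ + 1, _ + 1, _, _, h, h' => congrArg _ (JumpsAt.unique h.2 h'.2)

lemma exists_jumpsAt_of_le : ∀ {k : ℕ} {s t : ℝ} {η : ℕ → ℝ × Ξ}, JumpsAt k t η → 0 ≤ s → s ≤ t →
    ∃ j, JumpsAt j s η
  | 0, _, _, _, h, hs, hst => ⟨0, hs, hst.trans_lt h.2⟩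
  | k + 1, s, t, η, h, hs, hst => by
    by_cases h1 : s < (η 0).1
    · exact ⟨0, hs, h1⟩
    · obtain ⟨j, hj⟩ := exists_jumpsAt_of_le h.2 (sub_nonneg.mpr (not_lt.mp h1))
        (sub_le_sub_right hst _)
      exact ⟨j + 1, hs, hj⟩

lemma JumpsAt.add : ∀ {k j : ℕ} {s t : ℝ} {η : ℕ → ℝ × Ξ},
    JumpsAt k s η → JumpsAt j t (residualNoise k s η) → JumpsAt (j + k) (s + t) η
  | 0, 0, s, t, η, h, h' => ⟨add_nonneg h.1 h'.1, by
      have := h'.2; simp only [residualNoise, consNoise_zero] at this; linarith⟩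
  | 0, j + 1, s, t, η, h, h' => ⟨add_nonneg h.1 h'.1, by
      have := h'.2
      simp only [residualNoise, consNoise_zero, shiftNoise_consNoise] at this
      convert! this using 1; ring⟩
  | k + 1, j, s, t, η, h, h' => ⟨add_nonneg h.1 h'.nonneg, by
      have := JumpsAt.add h.2 h'
      convert! this using 1; ring⟩

lemma exists_jumpsAt_residualNoise : ∀ {k l : ℕ} {s t : ℝ} {η : ℕ → ℝ × Ξ},
    JumpsAt k s η → 0 ≤ t → JumpsAt l (s + t) η → ∃ j, JumpsAt j t (residualNoise k s η)
  | 0, 0, s, t, η, _, ht, h' => ⟨0, ht, by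
      have := h'.2; simp only [residualNoise, consNoise_zero]; linarith⟩
  | 0, l + 1, s, t, η, _, ht, h' => ⟨l + 1, ht, by
      have := h'.2
      simp only [residualNoise, consNoise_zero, shiftNoise_consNoise]
      convert! this using 1; ring⟩
  | k + 1, 0, s, t, η, h, ht, h' => by have := h.2.nonneg; have := h'.2; linarith
  | k + 1, l + 1, s, t, η, h, ht, h' => by
    have h2 := h'.2
    rw [show s + t - (η 0).1 = s - (η 0).1 + t by ring] at h2
    exact exists_jumpsAt_residualNoise (k := k) h.2 ht h2

/-- The value of `s` is immaterial: it only alters a waiting time in the residual noise, and `chain`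
reads only marks. -/
lemma chain_add (step : S → Ξ → S) : ∀ (k j : ℕ) (s : ℝ) (z : S) (η : ℕ → ℝ × Ξ),
    chain step (j + k) z η = chain step j (chain step k z η) (residualNoise k s η)
  | 0, 0, _, _, _ => rfl
  | 0, _ + 1, _, _, _ => rfl
  | k + 1, j, s, z, η => chain_add step k j (s - (η 0).1) (step z (η 0).2) (shiftNoise η)

open Classical in
/-- The state at time `t` of the process started from `z`. -/
noncomputable def flow (step : S → Ξ → S) (z : S) (t : ℝ) (η : ℕ → ℝ × Ξ) : S :=
  -- The default `z` matters only when no jump count exists, a null event for `t ≥ 0`.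
  if h : ∃ k, JumpsAt k t η then chain step h.choose z η else z

lemma flow_eq (step : S → Ξ → S) (z : S) {t : ℝ} {η : ℕ → ℝ × Ξ} {k : ℕ} (h : JumpsAt k t η) :
    flow step z t η = chain step k z η := by
  have h' : ∃ k, JumpsAt k t η := ⟨k, h⟩
  rw [flow, dif_pos h', JumpsAt.unique h'.choose_spec h]

/-- The one-step operator of the embedded chain. -/
noncomputable def stepOp [MeasurableSpace Ξ] [Fintype Ξ] (step : S → Ξ → S) (ν : Measure Ξ)
    (f : S → ℝ) : S → ℝ :=
  fun z => ∑ ξ, ν.real {ξ} * f (step z ξ)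

lemma stepOp_nonneg [MeasurableSpace Ξ] [Fintype Ξ] (step : S → Ξ → S) (ν : Measure Ξ)
    {f : S → ℝ} (hf : ∀ z, 0 ≤ f z) (z : S) : 0 ≤ stepOp step ν f z :=
  sum_nonneg fun _ _ => mul_nonneg measureReal_nonneg (hf _)

lemma stepOp_iterate_nonneg [MeasurableSpace Ξ] [Fintype Ξ] (step : S → Ξ → S) (ν : Measure Ξ)
    {f : S → ℝ} (hf : ∀ z, 0 ≤ f z) (k : ℕ) (z : S) : 0 ≤ ((stepOp step ν)^[k] f) z := by
  induction k generalizing z with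
  | zero => exact hf z
  | succ k ih => rw [Function.iterate_succ_apply']; exact stepOp_nonneg _ _ ih z

/-- The law of a sequence of independent exponential waiting times and marks. -/
noncomputable def noiseMeasure [MeasurableSpace Ξ] (r : ℝ) (ν : Measure Ξ) :
    Measure (ℕ → ℝ × Ξ) :=
  Measure.infinitePi fun _ : ℕ => (expMeasure r).prod ν

lemma JumpsAt.exists_right : ∀ {k : ℕ} {t : ℝ} {η : ℕ → ℝ × Ξ}, JumpsAt k t η →
    ∃ ε > 0, ∀ s, t ≤ s → s < t + ε → JumpsAt k s η
  | 0, t, η, h => ⟨(η 0).1 - t, sub_pos.mpr h.2, fun s h1 h2 => ⟨h.1.trans h1, by linarith⟩⟩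
  | k + 1, t, η, h => by
    obtain ⟨ε, hε, H⟩ := h.2.exists_right
    exact ⟨ε, hε, fun s h1 h2 => ⟨h.1.trans h1, H _ (by linarith) (by linarith)⟩⟩

lemma JumpsAt.exists_left : ∀ {k : ℕ} {t : ℝ} {η : ℕ → ℝ × Ξ}, JumpsAt k t η →
    (∀ n, 0 < (η n).1) → 0 < t → ∃ ε > 0, ∃ j, ∀ s, t - ε < s → s < t → JumpsAt j s η
  | 0, t, η, h, _, ht => ⟨t, ht, 0, fun s h1 h2 => ⟨by linarith, h2.trans h.2⟩⟩
  | k + 1, t, η, h, hη, ht => by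
    -- In the first case the first jump occurs exactly at `t`, so the count just before `t` is `0`;
    -- this is why the left count `j` may differ from `k + 1`.
    rcases h.2.nonneg.eq_or_lt with h0 | h0
    · exact ⟨t, ht, 0, fun s h1 h2 => ⟨by linarith, by linarith⟩⟩
    · obtain ⟨ε, hε, j, H⟩ := h.2.exists_left (fun n => hη (n + 1)) h0
      refine ⟨min ε t, lt_min hε ht, j + 1, fun s h1 h2 => ⟨?_, H _ ?_ ?_⟩⟩
      · have := min_le_right ε t; linarith
      · have := min_le_left ε t; linarith
      · linarith

section Measurability

variable [MeasurableSpace Ξ]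

lemma measurable_shiftNoise : Measurable (shiftNoise : (ℕ → ℝ × Ξ) → _) :=
  measurable_pi_lambda _ fun n => measurable_pi_apply (n + 1)

lemma measurable_consNoise :
    Measurable fun p : (ℝ × Ξ) × (ℕ → ℝ × Ξ) => consNoise p.1 p.2 := by
  refine measurable_pi_lambda _ fun n => ?_
  cases n with
  | zero => exact measurable_fst
  | succ n => exact (measurable_pi_apply n).comp measurable_snd

lemma measurable_consNoise_comp {α : Type*} [MeasurableSpace α] {a : α → ℝ × Ξ}
    {b : α → ℕ → ℝ × Ξ} (ha : Measurable a) (hb : Measurable b) :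
    Measurable fun x => consNoise (a x) (b x) :=
  measurable_consNoise.comp (ha.prodMk hb)

lemma measurableSet_jumpsAt (k : ℕ) :
    MeasurableSet {p : ℝ × (ℕ → ℝ × Ξ) | JumpsAt k p.1 p.2} := by
  induction k with
  | zero =>
    exact (measurableSet_le measurable_const measurable_fst).inter
      (measurableSet_lt measurable_fst ((measurable_pi_apply 0).comp measurable_snd).fst)
  | succ k ih =>
    refine (measurableSet_le measurable_const measurable_fst).inter (ih.preimage
      (f := fun p : ℝ × (ℕ → ℝ × Ξ) => (p.1 - (p.2 0).1, shiftNoise p.2)) ?_)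
    exact (measurable_fst.sub ((measurable_pi_apply 0).comp measurable_snd).fst).prodMk
      (measurable_shiftNoise.comp measurable_snd)

lemma measurable_residualNoise (k : ℕ) :
    Measurable fun p : ℝ × (ℕ → ℝ × Ξ) => residualNoise k p.1 p.2 := by
  have h0 : Measurable fun p : ℝ × (ℕ → ℝ × Ξ) => p.2 0 :=
    (measurable_pi_apply 0).comp measurable_snd
  induction k with
  | zero =>
    exact measurable_consNoise_comp ((h0.fst.sub measurable_fst).prodMk h0.snd)
      (measurable_shiftNoise.comp measurable_snd)
  | succ k ih =>
    exact ih.comp ((measurable_fst.sub h0.fst).prodMk (measurable_shiftNoise.comp measurable_snd))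

variable [Countable Ξ] [DiscreteMeasurableSpace Ξ]
  [MeasurableSpace S] [Countable S] [DiscreteMeasurableSpace S]

lemma measurable_chain (step : S → Ξ → S) (k : ℕ) :
    Measurable fun p : S × (ℕ → ℝ × Ξ) => chain step k p.1 p.2 := by
  induction k with
  | zero => exact measurable_fst
  | succ k ih =>
    have h : Measurable fun q : S × Ξ => step q.1 q.2 := Measurable.of_discrete
    exact ih.comp ((h.comp (measurable_fst.prodMk
      ((measurable_pi_apply 0).comp measurable_snd).snd)).prodMk
        (measurable_shiftNoise.comp measurable_snd))

lemma measurable_chain_right (step : S → Ξ → S) (k : ℕ) (z : S) :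
    Measurable (chain step k z) :=
  (measurable_chain step k).comp measurable_prodMk_left

lemma measurable_flow (step : S → Ξ → S) (t : ℝ) :
    Measurable fun p : S × (ℕ → ℝ × Ξ) => flow step p.1 t p.2 := by
  have hJ : ∀ k, MeasurableSet {p : S × (ℕ → ℝ × Ξ) | JumpsAt k t p.2} := fun k =>
    (measurableSet_jumpsAt k).preimage (measurable_const.prodMk measurable_snd)
  refine measurable_to_countable' fun x => ?_
  have : (fun p : S × (ℕ → ℝ × Ξ) => flow step p.1 t p.2) ⁻¹' {x} =
      (⋃ k, {p | JumpsAt k t p.2} ∩ (fun p => chain step k p.1 p.2) ⁻¹' {x}) ∪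
        ((⋃ k, {p | JumpsAt k t p.2})ᶜ ∩ Prod.fst ⁻¹' {x}) := by
    ext p
    by_cases h : ∃ k, JumpsAt k t p.2
    · obtain ⟨k, hk⟩ := h
      simp only [Set.mem_preimage, Set.mem_singleton_iff, flow_eq step p.1 hk, Set.mem_union,
        Set.mem_iUnion, Set.mem_inter_iff, Set.mem_ofPred_eq, Set.mem_compl_iff]
      constructor
      · intro h; exact Or.inl ⟨k, hk, h⟩
      · rintro (⟨l, hl, h⟩ | ⟨h, -⟩)
        · rwa [hk.unique hl]
        · exact absurd ⟨k, hk⟩ h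
    · simp [flow, dif_neg h]
      simp [not_exists.mp h]
  rw [this]
  exact (MeasurableSet.iUnion fun k => (hJ k).inter
    (measurable_chain step k (measurableSet_singleton x))).union
      ((MeasurableSet.iUnion hJ).compl.inter (measurable_fst (measurableSet_singleton x)))

end Measurability

end JumpProcess

/-! ### The Markov property of the noise. -/

section MarkovProperty

variable {S Ξ : Type} [MeasurableSpace Ξ]

instance {r : ℝ} [hr : Fact (0 < r)] : IsProbabilityMeasure (expMeasure r) :=
  isProbabilityMeasure_expMeasure hr.out

instance (r : ℝ) (ν : Measure Ξ) [Fact (0 < r)] [IsProbabilityMeasure ν] :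
    IsProbabilityMeasure (noiseMeasure r ν) := by
  unfold noiseMeasure; infer_instance

/-- The infinite product law is characterized by finite cylinders, and on those coordinate `0`
splits off from the shifted index set `s'`. This is what permits conditioning on the first jump. -/
lemma map_consNoise (r : ℝ) (ν : Measure Ξ) [Fact (0 < r)] [IsProbabilityMeasure ν] :
    (((expMeasure r).prod ν).prod (noiseMeasure r ν)).map (fun p => consNoise p.1 p.2)
      = noiseMeasure r ν := by
  refine Measure.eq_infinitePi _ fun s t ht => ?_
  rw [Measure.map_apply measurable_consNoise (MeasurableSet.pi s.countable_toSet fun i _ => ht i)]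
  set s' : Finset ℕ := s.preimage Nat.succ (Nat.succ_injective.injOn) with hs'
  have hmem : ∀ n, n ∈ s' ↔ n + 1 ∈ s := fun n => by simp [hs']
  have hset : (fun p : (ℝ × Ξ) × (ℕ → ℝ × Ξ) => consNoise p.1 p.2) ⁻¹' (Set.pi s t)
      = (if 0 ∈ s then t 0 else Set.univ) ×ˢ (Set.pi s' fun n => t (n + 1)) := by
    ext ⟨a, η⟩
    simp only [Set.mem_preimage, Set.mem_pi, Set.mem_prod, Finset.mem_coe, hmem]
    constructor
    · intro h
      refine ⟨?_, fun n hn => h (n + 1) hn⟩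
      split_ifs with h0
      · exact h 0 h0
      · trivial
    · rintro ⟨h0, h⟩ n hn
      cases n with
      | zero => rw [if_pos hn] at h0; exact h0
      | succ n => exact h n hn
  rw [hset, Measure.prod_prod, noiseMeasure, Measure.infinitePi_pi _ fun i _ => ht _]
  have hprod : ∏ i ∈ s, ((expMeasure r).prod ν) (t i)
      = (if 0 ∈ s then ((expMeasure r).prod ν) (t 0) else 1) *
        ∏ i ∈ s', ((expMeasure r).prod ν) (t (i + 1)) := by
    have himg : s'.image Nat.succ = s.erase 0 := by
      ext n
      cases n with
      | zero => simp
      | succ n => simp [hmem]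
    have h2 : ∏ i ∈ s', ((expMeasure r).prod ν) (t (i + 1))
        = ∏ i ∈ s.erase 0, ((expMeasure r).prod ν) (t i) := by
      rw [← himg, Finset.prod_image fun _ _ _ _ h => Nat.succ_injective h]
    rw [h2]
    split_ifs with h0
    · rw [Finset.mul_prod_erase _ (fun i => ((expMeasure r).prod ν) (t i)) h0]
    · rw [one_mul, Finset.erase_eq_of_notMem h0]
  rw [hprod]
  congr 1
  split_ifs <;> simp

lemma lintegral_noiseMeasure (r : ℝ) (ν : Measure Ξ) [Fact (0 < r)] [IsProbabilityMeasure ν]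
    [Fintype Ξ] [DiscreteMeasurableSpace Ξ] {G : (ℕ → ℝ × Ξ) → ℝ≥0∞} (hG : Measurable G) :
    ∫⁻ η, G η ∂(noiseMeasure r ν) = ∫⁻ T, ∑ ξ, ν {ξ} *
      ∫⁻ η, G (consNoise (T, ξ) η) ∂(noiseMeasure r ν) ∂(expMeasure r) := by
  have hm : Measurable fun p : (ℝ × Ξ) × (ℕ → ℝ × Ξ) => G (consNoise p.1 p.2) :=
    hG.comp measurable_consNoise
  conv_lhs => rw [← map_consNoise r ν]
  rw [lintegral_map hG measurable_consNoise, lintegral_prod _ hm.aemeasurable,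
    lintegral_prod _ hm.lintegral_prod_right'.aemeasurable]
  refine lintegral_congr fun T => ?_
  rw [lintegral_fintype]
  exact sum_congr rfl fun ξ _ => mul_comm _ _

variable [Fintype Ξ] [DiscreteMeasurableSpace Ξ]
  [MeasurableSpace S] [Countable S] [DiscreteMeasurableSpace S]

open Classical in
/-- The Markov property: given that `k` jumps have occurred by time `s`, the remaining noise is
independent of the past and is distributed like the whole noise. -/
lemma lintegral_residualNoise (r : ℝ) [hr : Fact (0 < r)] (ν : Measure Ξ)
    [IsProbabilityMeasure ν] (step : S → Ξ → S) {f : S → ℝ} (hf : ∀ z, 0 ≤ f z)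
    {G : (ℕ → ℝ × Ξ) → ℝ≥0∞} (hG : Measurable G) (k : ℕ) {s : ℝ} (hs : 0 ≤ s) (z : S) :
    ∫⁻ η, (if JumpsAt k s η then
        ENNReal.ofReal (f (chain step k z η)) * G (residualNoise k s η) else 0)
        ∂(noiseMeasure r ν)
      = ENNReal.ofReal (poissonWeight r s k * ((stepOp step ν)^[k] f) z) *
        ∫⁻ η, G η ∂(noiseMeasure r ν) := by
  have hmeas : ∀ (k : ℕ) (s : ℝ) (z : S), Measurable fun η : ℕ → ℝ × Ξ => if JumpsAt k s η then
      ENNReal.ofReal (f (chain step k z η)) * G (residualNoise k s η) else 0 := by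
    intro k s z
    refine Measurable.ite ((measurableSet_jumpsAt k).preimage measurable_prodMk_left) ?_
      measurable_const
    exact ((Measurable.of_discrete (f := f)).comp
      (measurable_chain_right step k z)).ennreal_ofReal.mul
        (hG.comp ((measurable_residualNoise k).comp measurable_prodMk_left))
  induction k generalizing s z with
  | zero =>
    rw [lintegral_noiseMeasure r ν (hmeas 0 s z), lintegral_noiseMeasure r ν hG]
    have hGm : Measurable fun T : ℝ => ∑ ξ, ν {ξ} *
        ∫⁻ η, G (consNoise (T, ξ) η) ∂(noiseMeasure r ν) := by
      refine Finset.measurable_sum _ fun ξ _ => Measurable.const_mul ?_ _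
      have h1 : Measurable fun p : ℝ × (ℕ → ℝ × Ξ) => G (consNoise (p.1, ξ) p.2) :=
        hG.comp (measurable_consNoise_comp (measurable_fst.prodMk measurable_const) measurable_snd)
      exact h1.lintegral_prod_right'
    -- With no jump by time `s`, the residual noise differs from the original only in the overshoot
    -- of the first clock, which is again exponential.
    have key := lintegral_expMeasure_memoryless r hs hGm
    have hp : ∀ T : ℝ, ∑ ξ, ν {ξ} * ∫⁻ η, (if JumpsAt 0 s (consNoise (T, ξ) η) then
        ENNReal.ofReal (f (chain step 0 z (consNoise (T, ξ) η))) *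
          G (residualNoise 0 s (consNoise (T, ξ) η)) else 0) ∂(noiseMeasure r ν)
        = ENNReal.ofReal (f z) * if s < T then ∑ ξ, ν {ξ} *
        ∫⁻ η, G (consNoise (T - s, ξ) η) ∂(noiseMeasure r ν) else 0 := by
      intro T
      by_cases h : s < T
      · rw [if_pos h, Finset.mul_sum]
        refine sum_congr rfl fun ξ _ => ?_
        simp only [JumpsAt, consNoise_zero, hs, h, and_self, if_true, chain, residualNoise,
          shiftNoise_consNoise]
        rw [lintegral_const_mul' _ _ ENNReal.ofReal_ne_top, mul_left_comm]
      · simp [JumpsAt, h]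
    simp_rw [hp]
    rw [lintegral_const_mul' _ _ ENNReal.ofReal_ne_top, key, ← mul_assoc,
      ← ENNReal.ofReal_mul (hf z)]
    congr 2
    simp [poissonWeight, mul_comm]
  | succ k ih =>
    rw [lintegral_noiseMeasure r ν (hmeas (k + 1) s z)]
    have hp : ∀ T : ℝ, ∑ ξ, ν {ξ} * ∫⁻ η, (if JumpsAt (k + 1) s (consNoise (T, ξ) η) then
        ENNReal.ofReal (f (chain step (k + 1) z (consNoise (T, ξ) η))) *
          G (residualNoise (k + 1) s (consNoise (T, ξ) η)) else 0) ∂(noiseMeasure r ν)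
        = (ENNReal.ofReal (((stepOp step ν)^[k + 1] f) z) *
            ∫⁻ η, G η ∂(noiseMeasure r ν)) *
          if T ≤ s then ENNReal.ofReal (poissonWeight r (s - T) k) else 0 := by
      -- Given a first jump at `T ≤ s` with mark `ξ`, the induction hypothesis applies with time `s
      -- - T` and state `step z ξ`; averaging over `ξ` supplies the extra factor of `stepOp`.
      intro T
      by_cases h : T ≤ s
      · rw [if_pos h]
        have h2 : ∀ ξ, ∫⁻ η, (if JumpsAt (k + 1) s (consNoise (T, ξ) η) then
            ENNReal.ofReal (f (chain step (k + 1) z (consNoise (T, ξ) η))) *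
            G (residualNoise (k + 1) s (consNoise (T, ξ) η)) else 0) ∂(noiseMeasure r ν)
            = ENNReal.ofReal (poissonWeight r (s - T) k *
              ((stepOp step ν)^[k] f) (step z ξ)) * ∫⁻ η, G η ∂(noiseMeasure r ν) := by
          intro ξ
          rw [← ih (sub_nonneg.mpr h) (step z ξ)]
          simp only [JumpsAt, consNoise_zero, hs, true_and, chain, residualNoise,
            shiftNoise_consNoise]
        simp_rw [h2]
        rw [Function.iterate_succ_apply', stepOp, ENNReal.ofReal_sum_of_nonneg, mul_right_comm,
          Finset.sum_mul, Finset.sum_mul]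
        · refine sum_congr rfl fun ξ _ => ?_
          rw [← mul_assoc]
          congr 1
          rw [ENNReal.ofReal_mul (poissonWeight_nonneg hr.out.le (sub_nonneg.mpr h) k),
            ENNReal.ofReal_mul measureReal_nonneg, ofReal_measureReal]
          ring
        · exact fun ξ _ => mul_nonneg measureReal_nonneg (stepOp_iterate_nonneg _ _ hf _ _)
      · rw [if_neg h, mul_zero]
        refine sum_eq_zero fun ξ _ => ?_
        have h2 : ∀ η : ℕ → ℝ × Ξ, ¬ JumpsAt (k + 1) s (consNoise (T, ξ) η) := by
          intro η hj
          have := hj.2.nonneg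
          rw [consNoise_zero] at this
          exact h (by linarith)
        simp [h2]
    simp_rw [hp]
    have hc : Continuous fun T => poissonWeight r (s - T) k := by
      unfold poissonWeight; fun_prop
    rw [lintegral_const_mul _ (Measurable.ite measurableSet_Iic hc.measurable.ennreal_ofReal
      measurable_const), lintegral_expMeasure_poissonWeight hr.out hs k, mul_right_comm,
      ← ENNReal.ofReal_mul (stepOp_iterate_nonneg _ _ hf _ _), mul_comm (poissonWeight r s (k + 1))]

end MarkovProperty

/-! ### The one-step operator and its Poisson mixtures. -/

section StepOperator

variable {S Ξ : Type} [MeasurableSpace Ξ] [Fintype Ξ]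

/-- The transition function of the uniformized process. -/
noncomputable def jumpTransition (r : ℝ) (ν : Measure Ξ) (step : S → Ξ → S) (t : ℝ) (x y : S) : ℝ :=
  ∑' k, poissonWeight r t k * ((stepOp step ν)^[k] (({y} : Set S).indicator 1)) x

lemma stepOp_mono (ν : Measure Ξ) (step : S → Ξ → S) {f g : S → ℝ} (h : ∀ z, f z ≤ g z) (z : S) :
    stepOp step ν f z ≤ stepOp step ν g z :=
  sum_le_sum fun _ _ => mul_le_mul_of_nonneg_left (h _) measureReal_nonneg

lemma sum_measureReal_singleton [MeasurableSingletonClass Ξ] (ν : Measure Ξ) [IsProbabilityMeasure ν] :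
    ∑ ξ, ν.real {ξ} = 1 := by
  simp

lemma stepOp_const [MeasurableSingletonClass Ξ] (ν : Measure Ξ) [IsProbabilityMeasure ν] (step : S → Ξ → S) (c : ℝ) :
    stepOp step ν (fun _ => c) = fun _ => c := by
  funext z
  rw [stepOp, ← Finset.sum_mul, sum_measureReal_singleton, one_mul]

lemma stepOp_iterate_const [MeasurableSingletonClass Ξ] (ν : Measure Ξ) [IsProbabilityMeasure ν] (step : S → Ξ → S) (c : ℝ)
    (k : ℕ) : (stepOp step ν)^[k] (fun _ => c) = fun _ => c :=
  Function.iterate_fixed (stepOp_const ν step c) k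

lemma stepOp_iterate_mono (ν : Measure Ξ) (step : S → Ξ → S) {f g : S → ℝ}
    (h : ∀ z, f z ≤ g z) (k : ℕ) (z : S) :
    ((stepOp step ν)^[k] f) z ≤ ((stepOp step ν)^[k] g) z := by
  induction k generalizing z with
  | zero => exact h z
  | succ k ih => simp only [Function.iterate_succ_apply']; exact stepOp_mono ν step ih z

lemma stepOp_iterate_le_const [MeasurableSingletonClass Ξ] (ν : Measure Ξ) [IsProbabilityMeasure ν] (step : S → Ξ → S)
    {f : S → ℝ} {c : ℝ} (h : ∀ z, f z ≤ c) (k : ℕ) (z : S) : ((stepOp step ν)^[k] f) z ≤ c :=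
  (stepOp_iterate_mono ν step h k z).trans_eq (congrFun (stepOp_iterate_const ν step c k) z)

lemma summable_poissonWeight_mul {r t : ℝ} (hr : 0 ≤ r) (ht : 0 ≤ t) {a : ℕ → ℝ} {B : ℝ}
    (h0 : ∀ k, 0 ≤ a k) (h1 : ∀ k, a k ≤ B) : Summable fun k => poissonWeight r t k * a k :=
  Summable.of_nonneg_of_le (fun k => mul_nonneg (poissonWeight_nonneg hr ht k) (h0 k))
    (fun k => mul_le_mul_of_nonneg_left (h1 k) (poissonWeight_nonneg hr ht k))
    ((hasSum_poissonWeight r t).summable.mul_right B)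

lemma jumpTransition_nonneg {r t : ℝ} (hr : 0 ≤ r) (ht : 0 ≤ t) (ν : Measure Ξ)
    (step : S → Ξ → S) (x y : S) : 0 ≤ jumpTransition r ν step t x y :=
  tsum_nonneg fun k => mul_nonneg (poissonWeight_nonneg hr ht k)
    (stepOp_iterate_nonneg _ _ (Set.indicator_nonneg fun _ _ => zero_le_one) _ _)

end StepOperator

/-! ### Finite-dimensional laws, means and paths of the flow. -/

section FiniteDimensional

variable {S Ξ : Type} [MeasurableSpace Ξ] [Fintype Ξ] [DiscreteMeasurableSpace Ξ]
  [MeasurableSpace S] [Countable S] [DiscreteMeasurableSpace S]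
  (r : ℝ) [hr : Fact (0 < r)] (ν : Measure Ξ) [IsProbabilityMeasure ν] (step : S → Ξ → S)

-- The Markov identity for indicator functions, summed over the disjoint events that exactly `k`
-- jumps have occurred.
open Classical in
lemma noiseMeasure_jump_and_residual {A : Set (ℕ → ℝ × Ξ)} (hA : MeasurableSet A) {s : ℝ}
    (hs : 0 ≤ s) (z y : S) :
    noiseMeasure r ν {η | ∃ k, JumpsAt k s η ∧ chain step k z η = y ∧ residualNoise k s η ∈ A}
      = ENNReal.ofReal (jumpTransition r ν step s z y) * noiseMeasure r ν A := by
  set f : S → ℝ := ({y} : Set S).indicator 1 with hfdef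
  have hf : ∀ z, 0 ≤ f z := Set.indicator_nonneg fun _ _ => zero_le_one
  have hf1 : ∀ z, f z ≤ 1 := Set.indicator_le_self' fun _ _ => zero_le_one
  set B : ℕ → Set (ℕ → ℝ × Ξ) := fun k =>
    {η | JumpsAt k s η ∧ chain step k z η = y ∧ residualNoise k s η ∈ A} with hB
  have hBm : ∀ k, MeasurableSet (B k) := fun k =>
    ((measurableSet_jumpsAt k).preimage measurable_prodMk_left).inter
      (((measurable_chain_right step k z) (measurableSet_singleton y)).inter
        (hA.preimage ((measurable_residualNoise k).comp measurable_prodMk_left)))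
  have hU : {η | ∃ k, JumpsAt k s η ∧ chain step k z η = y ∧ residualNoise k s η ∈ A}
      = ⋃ k, B k := by ext η; simp [hB]
  rw [hU, measure_iUnion (fun k l hkl => Set.disjoint_left.mpr fun η h h' =>
    hkl (h.1.unique h'.1)) hBm]
  have hBk : ∀ k, noiseMeasure r ν (B k) = ENNReal.ofReal (poissonWeight r s k *
      ((stepOp step ν)^[k] f) z) * noiseMeasure r ν A := by
    intro k
    have h := lintegral_residualNoise r ν step hf (G := A.indicator 1)
      (measurable_one.indicator hA) k hs z
    rw [lintegral_indicator_one hA] at h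
    rw [← h, ← lintegral_indicator_one (hBm k)]
    refine lintegral_congr fun η => ?_
    by_cases h1 : JumpsAt k s η <;> by_cases h2 : chain step k z η = y <;>
      by_cases h3 : residualNoise k s η ∈ A <;> simp [Set.indicator, hB, hfdef, h1, h2, h3]
  simp_rw [hBk]
  rw [ENNReal.tsum_mul_right, ← ENNReal.ofReal_tsum_of_nonneg]
  · rfl
  · exact fun k => mul_nonneg (poissonWeight_nonneg hr.out.le hs k)
      (stepOp_iterate_nonneg _ _ hf _ _)
  · exact summable_poissonWeight_mul hr.out.le hs
      (fun k => stepOp_iterate_nonneg _ _ hf _ _) (fun k => stepOp_iterate_le_const ν step hf1 _ _)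

/-- Non-explosion is read off from the chain on a one-point space, whose transition probability is
the total mass `1` of the Poisson weights. -/
lemma ae_exists_jumpsAt {t : ℝ} (ht : 0 ≤ t) :
    ∀ᵐ η ∂(noiseMeasure r ν), ∃ k, JumpsAt k t η := by
  have h := noiseMeasure_jump_and_residual r ν (fun (_ : Unit) (_ : Ξ) => ()) MeasurableSet.univ
    ht () ()
  have h1 : jumpTransition r ν (fun (_ : Unit) (_ : Ξ) => ()) t () () = 1 := by
    unfold jumpTransition
    have : ({()} : Set Unit).indicator (1 : Unit → ℝ) = fun _ => 1 := by funext z; simp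
    rw [this]
    simp_rw [stepOp_iterate_const, mul_one]
    exact (hasSum_poissonWeight r t).tsum_eq
  rw [h1, measure_univ, ENNReal.ofReal_one, one_mul] at h
  have hm : MeasurableSet {η : ℕ → ℝ × Ξ | ∃ k, JumpsAt k t η} := by
    rw [Set.ofPred_exists]
    exact MeasurableSet.iUnion fun k => (measurableSet_jumpsAt k).preimage measurable_prodMk_left
  refine (prob_compl_eq_zero_iff hm).mpr ?_
  rw [← h]
  congr 1
  ext η
  simp

omit [Fintype Ξ] [DiscreteMeasurableSpace Ξ] in
lemma ae_pos_noiseMeasure : ∀ᵐ η ∂(noiseMeasure r ν), ∀ n, 0 < (η n).1 := by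
  have h1 : ∀ᵐ T ∂(expMeasure r), 0 < T := by
    rw [ae_iff]
    simp only [not_lt]
    have hm : MeasurableSet {T : ℝ | T ≤ 0} := measurableSet_Iic
    rw [← lintegral_indicator_one hm, lintegral_expMeasure r (measurable_one.indicator hm)]
    have h0 : ∀ᵐ T : ℝ, T ≠ 0 := by simp [ae_iff]
    refine (lintegral_congr_ae (h0.mono fun T hT => ?_)).trans lintegral_zero
    rcases lt_or_gt_of_ne hT with h | h
    · simp [exponentialPDF_of_neg h]
    · simp [Set.indicator, h]
  rw [ae_all_iff]
  intro n
  have h2 : ∀ᵐ p ∂((expMeasure r).prod ν), 0 < p.1 :=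
    Measure.quasiMeasurePreserving_fst.ae h1
  exact (measurePreserving_eval_infinitePi (fun _ : ℕ => (expMeasure r).prod ν)
    n).quasiMeasurePreserving.ae h2

lemma noiseMeasure_flow (n : ℕ) (z : S) (t : Fin (n + 1) → ℝ) (x : Fin (n + 1) → S)
    (ht : Monotone t) (h0 : t 0 = 0) (hx : x 0 = z) :
    noiseMeasure r ν {η | ∀ i, flow step z (t i) η = x i} = ENNReal.ofReal (∏ i : Fin n,
      jumpTransition r ν step (t i.succ - t i.castSucc) (x i.castSucc) (x i.succ)) := by
  have hflow0 : ∀ z : S, ∀ᵐ η ∂(noiseMeasure r ν), flow step z 0 η = z := fun z =>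
    (ae_pos_noiseMeasure r ν).mono fun η hη => flow_eq step z (k := 0) ⟨le_rfl, hη 0⟩
  induction n generalizing z with
  | zero =>
    simp only [univ_eq_empty, prod_empty, ENNReal.ofReal_one]
    refine (measure_congr (t := Set.univ) ?_).trans measure_univ
    filter_upwards [hflow0 z] with η hη
    refine propext ⟨fun _ => trivial, fun _ i => ?_⟩
    rw [Fin.fin_one_eq_zero i, h0, hη, hx]
  | succ n ih =>
    have hnn : ∀ i, 0 ≤ t i := fun i => h0 ▸ ht (Fin.zero_le i)
    set t' : Fin (n + 1) → ℝ := fun i => t i.succ - t 1 with ht'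
    have ht'nn : ∀ i, 0 ≤ t' i := fun i =>
      sub_nonneg.mpr (ht (by rw [← Fin.succ_zero_eq_one]; exact Fin.succ_le_succ_iff.mpr i.zero_le))
    -- The process is restarted at time `t 1`. Existence of the jump counts is built into the event
    -- because paths can be concatenated only where the counts exist.
    set good : Set (ℕ → ℝ × Ξ) := {η | ∀ i, (∃ j, JumpsAt j (t' i) η) ∧
      flow step (x 1) (t' i) η = x i.succ} with hgood
    have hgm : MeasurableSet good := by
      rw [hgood, Set.ofPred_forall]
      refine MeasurableSet.iInter fun i => MeasurableSet.inter ?_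
        (((measurable_flow step (t' i)).comp measurable_prodMk_left) (measurableSet_singleton _))
      change MeasurableSet {η : ℕ → ℝ × Ξ | ∃ k, JumpsAt k (t' i) η}
      rw [Set.ofPred_exists]
      exact MeasurableSet.iUnion fun k => (measurableSet_jumpsAt k).preimage measurable_prodMk_left
    have hgoodQ : noiseMeasure r ν good = ENNReal.ofReal (∏ i : Fin n, jumpTransition r ν step
        (t i.succ.succ - t i.castSucc.succ) (x i.castSucc.succ) (x i.succ.succ)) := by
      have h1 := ih (x 1) t' (fun i => x i.succ)
        (fun i j hij => sub_le_sub_right (ht (Fin.succ_le_succ_iff.mpr hij)) _)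
        (by simp [ht']) rfl
      have h2 : noiseMeasure r ν good
          = noiseMeasure r ν {η | ∀ i, flow step (x 1) (t' i) η = x i.succ} := by
        refine measure_congr ?_
        filter_upwards [ae_all_iff.mpr fun i => ae_exists_jumpsAt r ν (ht'nn i)] with η hη
        exact propext ⟨fun h i => (h i).2, fun h i => ⟨hη i, h i⟩⟩
      rw [h2, h1]
      simp [ht']
    have hmain := noiseMeasure_jump_and_residual r ν step hgm (hnn 1) z (x 1)
    rw [Fin.prod_univ_succ, ENNReal.ofReal_mul (jumpTransition_nonneg hr.out.le
      (sub_nonneg.mpr (ht (Fin.castSucc_le_succ 0))) ν step _ _)]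
    simp only [Fin.castSucc_zero, h0, hx, Fin.succ_zero_eq_one, sub_zero, ← Fin.succ_castSucc]
    rw [← hgoodQ, ← hmain]
    refine measure_congr ?_
    filter_upwards [hflow0 z, ae_all_iff.mpr fun i => ae_exists_jumpsAt r ν (hnn i)] with η hη0 hη
    refine propext ⟨fun h => ?_, ?_⟩
    · obtain ⟨k, hk⟩ := hη 1
      have hk1 : chain step k z η = x 1 := by rw [← flow_eq step z hk]; exact h 1
      refine ⟨k, hk, hk1, fun i => ?_⟩
      obtain ⟨l, hl⟩ := hη i.succ
      have e : t 1 + t' i = t i.succ := by simp [ht']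
      obtain ⟨j, hj⟩ := exists_jumpsAt_residualNoise hk (ht'nn i) (e.symm ▸ hl)
      refine ⟨⟨j, hj⟩, ?_⟩
      have h3 := hk.add hj
      rw [e] at h3
      rw [flow_eq step _ hj, ← hk1, ← chain_add, ← flow_eq step z h3]
      exact h i.succ
    · rintro ⟨k, hk, hk1, hres⟩ i
      refine Fin.cases ?_ (fun i => ?_) i
      · rw [h0, hη0, hx]
      · obtain ⟨⟨j, hj⟩, hf⟩ := hres i
        have e : t 1 + t' i = t i.succ := by simp [ht']
        have h3 := hk.add hj
        rw [e] at h3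
        rw [flow_eq step z h3, chain_add step k j (t 1), hk1, ← flow_eq step _ hj]
        exact hf

variable {Ω : Type} [MeasurableSpace Ω] (P : Measure Ω)

lemma measureReal_flow {X : Ω → S} (hX : Measurable X) (n : ℕ)
    (t : Fin (n + 1) → ℝ) (x : Fin (n + 1) → S) (ht : Monotone t) (h0 : t 0 = 0) :
    (P.prod (noiseMeasure r ν)).real {ω | ∀ i, flow step (X ω.1) (t i) ω.2 = x i}
      = (P.map X).real {x 0} * ∏ i : Fin n,
      jumpTransition r ν step (t i.succ - t i.castSucc) (x i.castSucc) (x i.succ) := by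
  have hm : MeasurableSet {ω : Ω × (ℕ → ℝ × Ξ) | ∀ i, flow step (X ω.1) (t i) ω.2 = x i} := by
    rw [Set.ofPred_forall]
    exact MeasurableSet.iInter fun i => ((measurable_flow step (t i)).comp
      ((hX.comp measurable_fst).prodMk measurable_snd)) (measurableSet_singleton _)
  have hp : ∀ ω, noiseMeasure r ν
      (Prod.mk ω ⁻¹' {ω : Ω × (ℕ → ℝ × Ξ) | ∀ i, flow step (X ω.1) (t i) ω.2 = x i})
      = (X ⁻¹' {x 0}).indicator (fun _ => ENNReal.ofReal (∏ i : Fin n,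
      jumpTransition r ν step (t i.succ - t i.castSucc) (x i.castSucc) (x i.succ))) ω := by
    intro ω
    by_cases h : X ω = x 0
    · rw [Set.indicator_of_mem (by exact h)]
      exact noiseMeasure_flow r ν step n (X ω) t x ht h0 h.symm
    · rw [Set.indicator_of_notMem (by exact h)]
      refine (measure_congr (t := ∅) ?_).trans measure_empty
      filter_upwards [ae_pos_noiseMeasure r ν] with η hη
      refine propext ⟨fun h' => h ?_, fun h' => h'.elim⟩
      have h3 := h' 0
      rwa [h0, flow_eq step (X ω) (k := 0) ⟨le_rfl, hη 0⟩] at h3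
  have hnn : 0 ≤ ∏ i : Fin n,
      jumpTransition r ν step (t i.succ - t i.castSucc) (x i.castSucc) (x i.succ) :=
    prod_nonneg fun i _ => jumpTransition_nonneg hr.out.le
      (sub_nonneg.mpr (ht (Fin.castSucc_le_succ i))) ν step _ _
  rw [measureReal_def, Measure.prod_apply hm]
  simp_rw [hp]
  rw [lintegral_indicator (hX (measurableSet_singleton _)), lintegral_const,
    Measure.restrict_apply_univ, ENNReal.toReal_mul, ENNReal.toReal_ofReal hnn, mul_comm,
    measureReal_def, Measure.map_apply hX (measurableSet_singleton _)]

/-- The bridge from the embedded chain to continuous time: the number of jumps by time `t` is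
Poisson, and given that it is `k` the mean is the `k`-th iterate of the one-step operator. -/
lemma lintegral_flow {X : Ω → S} (hX : Measurable X) {f : S → ℝ} (hf : ∀ z, 0 ≤ f z) {t : ℝ}
    (ht : 0 ≤ t) :
    ∫⁻ ω, ENNReal.ofReal (f (flow step (X ω.1) t ω.2)) ∂(P.prod (noiseMeasure r ν))
      = ∑' k, ENNReal.ofReal (poissonWeight r t k) *
        ∫⁻ ω, ENNReal.ofReal (((stepOp step ν)^[k] f) (X ω)) ∂P := by
  classical
  have hfm : ∀ g : S → ℝ, Measurable fun z => ENNReal.ofReal (g z) := fun g =>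
    Measurable.of_discrete
  have hm : Measurable fun ω : Ω × (ℕ → ℝ × Ξ) =>
      ENNReal.ofReal (f (flow step (X ω.1) t ω.2)) :=
    (hfm f).comp ((measurable_flow step t).comp ((hX.comp measurable_fst).prodMk measurable_snd))
  rw [lintegral_prod _ hm.aemeasurable]
  have hz : ∀ z, ∫⁻ η, ENNReal.ofReal (f (flow step z t η)) ∂(noiseMeasure r ν)
      = ∑' k, ENNReal.ofReal (poissonWeight r t k) *
        ENNReal.ofReal (((stepOp step ν)^[k] f) z) := by
    intro z
    have h1 : ∀ k, ENNReal.ofReal (poissonWeight r t k) *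
        ENNReal.ofReal (((stepOp step ν)^[k] f) z) = ∫⁻ η, (if JumpsAt k t η then
        ENNReal.ofReal (f (chain step k z η)) else 0) ∂(noiseMeasure r ν) := by
      intro k
      have h := lintegral_residualNoise r ν step hf (G := fun _ => 1) measurable_const k ht z
      simp only [mul_one, lintegral_const, measure_univ] at h
      rw [h, ENNReal.ofReal_mul (poissonWeight_nonneg hr.out.le ht k)]
    simp_rw [h1]
    have h2 : ∀ k, Measurable fun η : ℕ → ℝ × Ξ =>
        if JumpsAt k t η then ENNReal.ofReal (f (chain step k z η)) else 0 := fun k =>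
      Measurable.ite ((measurableSet_jumpsAt k).preimage measurable_prodMk_left)
        ((hfm f).comp (measurable_chain_right step k z)) measurable_const
    rw [← lintegral_tsum fun k => (h2 k).aemeasurable]
    refine lintegral_congr_ae ((ae_exists_jumpsAt r ν ht).mono ?_)
    rintro η ⟨k, hk⟩
    simp only
    rw [flow_eq step z hk, tsum_eq_single k fun l hl => if_neg fun h => hl (h.unique hk), if_pos hk]
  simp_rw [hz]
  have h3 : ∀ k, Measurable fun ω => ENNReal.ofReal (((stepOp step ν)^[k] f) (X ω)) := fun k =>
    (hfm _).comp hX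
  rw [lintegral_tsum fun k => ((h3 k).const_mul _).aemeasurable]
  exact tsum_congr fun k => lintegral_const_mul _ (h3 k)

omit [MeasurableSpace S] [Countable S] [DiscreteMeasurableSpace S] in
lemma ae_cadlag_flow [TopologicalSpace S] (X : Ω → S) :
    ∀ᵐ ω ∂(P.prod (noiseMeasure r ν)), ∀ t : ℝ≥0,
      ContinuousWithinAt (fun s : ℝ≥0 => flow step (X ω.1) s ω.2) (Set.Ici t) t ∧
      ∃ y : S, Tendsto (fun s : ℝ≥0 => flow step (X ω.1) s ω.2) (𝓝[<] t) (𝓝 y) := by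
  -- Countably many times suffice: a jump count at an integer `m ≥ t` gives one at `t` by
  -- `exists_jumpsAt_of_le`, so a single null set serves all times.
  have h : ∀ᵐ ω ∂(P.prod (noiseMeasure r ν)),
      (∀ n, 0 < (ω.2 n).1) ∧ ∀ m : ℕ, ∃ k, JumpsAt k (m : ℝ) ω.2 :=
    Measure.quasiMeasurePreserving_snd.ae ((ae_pos_noiseMeasure r ν).and
      (ae_all_iff.mpr fun m => ae_exists_jumpsAt r ν (Nat.cast_nonneg m)))
  filter_upwards [h] with ω hω t
  obtain ⟨m, hm⟩ := exists_nat_ge (t : ℝ)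
  obtain ⟨k, hk⟩ := hω.2 m
  obtain ⟨j, hj⟩ := exists_jumpsAt_of_le hk t.coe_nonneg hm
  constructor
  · obtain ⟨ε, hε, H⟩ := hj.exists_right
    refine continuousWithinAt_const (b := flow step (X ω.1) t ω.2) |>.congr_of_eventuallyEq ?_ rfl
    have hlt : ∀ᶠ s : ℝ≥0 in 𝓝 t, (s : ℝ) < t + ε :=
      NNReal.continuous_coe.continuousAt.eventually_lt continuousAt_const (by linarith)
    filter_upwards [nhdsWithin_le_nhds hlt, self_mem_nhdsWithin] with s h1 h2
    rw [flow_eq step _ (H s h2 h1), flow_eq step _ hj]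
  · rcases t.coe_nonneg.eq_or_lt with h0 | h0
    · have : t = 0 := NNReal.coe_injective h0.symm
      refine ⟨X ω.1, ?_⟩
      have hbot : 𝓝[<] t = ⊥ := by
        rw [this]
        have : Set.Iio (0 : ℝ≥0) = ∅ := by ext; simp
        rw [this, nhdsWithin_empty]
      rw [hbot]; exact tendsto_bot
    · obtain ⟨ε, hε, l, H⟩ := hj.exists_left hω.1 h0
      refine ⟨chain step l (X ω.1) ω.2, tendsto_const_nhds.congr' ?_⟩
      have hlt : ∀ᶠ s : ℝ≥0 in 𝓝 t, (t : ℝ) - ε < s :=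
        continuousAt_const.eventually_lt NNReal.continuous_coe.continuousAt (by linarith)
      filter_upwards [nhdsWithin_le_nhds hlt, self_mem_nhdsWithin] with s h1 h2
      exact (flow_eq step _ (H s h1 (NNReal.coe_lt_coe.mpr h2))).symm

end FiniteDimensional

/-! ### The event map of the queues and the law of the marks. -/

section QueueStep

variable {V W : Type} [Fintype V] [DecidableEq V] [Fintype W] [DecidableEq W]

/-- The tie-breaking rankings of the servers. -/
abbrev Ranking (V : Type) [Fintype V] : Type := V ≃ Fin (Fintype.card V)

/-- The mark of an event: an arrival at a dispatcher, with its sample of servers and a ranking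
of the servers that breaks ties, or a potential departure at a server. -/
abbrev Mark (E : Finset (V × W)) (d : ℕ) : Type :=
  ((Σ w : W, (Fin d → serversOf E w)) × Ranking V) ⊕ V

instance (E : Finset (V × W)) (d : ℕ) : MeasurableSpace (Mark E d) := ⊤

instance (E : Finset (V × W)) (d : ℕ) : DiscreteMeasurableSpace (Mark E d) := ⟨fun _ => trivial⟩

variable {E : Finset (V × W)} {d : ℕ}

/-- The highest ranked one of the shortest queues in the sample (as a set). -/
def joined {w : W} (x : State V) (s : Fin d → serversOf E w) (σ : Ranking V) : Finset V :=
  {v ∈ shortest x s | ∀ u ∈ shortest x s, σ v ≤ σ u}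

/-- The effect of an event on the queue lengths. -/
def queueStep (x : State V) : Mark E d → State V
  | .inl (a, σ) => fun v => x v + if v ∈ joined x a.2 σ then 1 else 0
  -- Truncated subtraction makes a potential departure from an empty queue do nothing.
  | .inr v => Function.update x v (x v - 1)

lemma mem_shortest {w : W} {x : State V} {s : Fin d → serversOf E w} {v : V} :
    v ∈ shortest x s ↔ (∃ j, (s j : V) = v) ∧ ∀ j, x v ≤ x (s j) := by
  simp [shortest]

lemma shortest_nonempty {w : W} (hd : 0 < d) (x : State V) (s : Fin d → serversOf E w) :
    (shortest x s).Nonempty := by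
  obtain ⟨j, -, hj⟩ := exists_min_image univ (fun j => x (s j)) ⟨⟨0, hd⟩, mem_univ _⟩
  exact ⟨s j, mem_shortest.mpr ⟨⟨j, rfl⟩, fun i => hj i (mem_univ i)⟩⟩

/-- The first element of `A` in the ranking `σ`, as a set. -/
lemma exists_first {A : Finset V} (hA : A.Nonempty) (σ : Ranking V) :
    ∃ v, {v ∈ A | ∀ u ∈ A, σ v ≤ σ u} = {v} := by
  obtain ⟨v, hv, hmin⟩ := exists_min_image A σ hA
  refine ⟨v, ?_⟩
  ext u
  simp only [mem_filter, mem_singleton]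
  constructor
  · rintro ⟨hu, h⟩
    exact σ.injective (le_antisymm (h v hv) (hmin u hu))
  · rintro rfl
    exact ⟨hv, hmin⟩

lemma exists_joined {w : W} (hd : 0 < d) (x : State V) (s : Fin d → serversOf E w)
    (σ : Ranking V) : ∃ v, joined x s σ = {v} :=
  exists_first (shortest_nonempty hd x s) σ

lemma joined_subset {w : W} {x : State V} {s : Fin d → serversOf E w} {σ : Ranking V} {v : V}
    (h : v ∈ joined x s σ) : v ∈ shortest x s :=
  (mem_filter.mp h).1

lemma queueStep_arrival {x : State V} {a : Σ w : W, (Fin d → serversOf E w)} {σ : Ranking V} {v : V}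
    (h : joined x a.2 σ = {v}) :
    queueStep x (.inl (a, σ) : Mark E d) = Function.update x v (x v + 1) := by
  funext u
  simp only [queueStep, h, mem_singleton, Function.update_apply]
  split_ifs with hu
  · rw [hu]
  · rfl

lemma sum_queueStep_arrival (hd : 0 < d) (x : State V) (a : Σ w : W, (Fin d → serversOf E w))
    (σ : Ranking V) :
    ∑ v, (queueStep x (.inl (a, σ) : Mark E d) v : ℝ) = ∑ v, (x v : ℝ) + 1 := by
  obtain ⟨v, hv⟩ := exists_joined hd x a.2 σ
  simp only [queueStep, hv, mem_singleton]
  push_cast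
  rw [sum_add_distrib]
  simp

/-- The same event preserves the coordinatewise order. -/
lemma queueStep_mono {x y : State V} (h : ∀ v, x v ≤ y v) (ξ : Mark E d) (v : V) :
    queueStep x ξ v ≤ queueStep y ξ v := by
  rcases ξ with ⟨a, σ⟩ | u
  · simp only [queueStep]
    by_cases hx : v ∈ joined x a.2 σ
    -- Only the case `x v = y v` is at risk. There `v` is also shortest in the sample for `y`, and
    -- every shortest `u` for `y` is shortest for `x`, since `x u ≤ y u ≤ y v = x v`. The common
    -- ranking, which put `v` ahead of `u` for `x`, therefore selects `v` for `y` too.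
    · rcases (h v).eq_or_lt with he | hlt
      · have hx' := mem_filter.mp hx
        have hs := mem_shortest.mp hx'.1
        have hy : v ∈ joined y a.2 σ := by
          refine mem_filter.mpr ⟨mem_shortest.mpr ⟨hs.1, fun j => ?_⟩, fun u hu => ?_⟩
          · exact he ▸ (hs.2 j).trans (h _)
          · have hu' := mem_shortest.mp hu
            refine hx'.2 u (mem_shortest.mpr ⟨hu'.1, fun j => ?_⟩)
            obtain ⟨i, hi⟩ := hs.1
            have h1 := hu'.2 i
            rw [hi, ← he] at h1
            exact (h u).trans (h1.trans (hs.2 j))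
        rw [if_pos hx, if_pos hy, he]
      · rw [if_pos hx]
        exact (Nat.succ_le_of_lt hlt).trans (Nat.le_add_right _ _)
    · rw [if_neg hx]
      exact (h v).trans (Nat.le_add_right _ _)
  · simp only [queueStep, Function.update_apply]
    split_ifs
    · exact Nat.sub_le_sub_right (h u) 1
    · exact h v

/-- The total rate of arrivals and potential departures. -/
noncomputable def totalRate (V : Type) [Fintype V] (lam : ℝ) : ℝ := (Fintype.card V : ℝ) * (lam + 1)

/-- The probability of a mark. -/
noncomputable def markWeight (E : Finset (V × W)) (d : ℕ) (lam : ℝ) : Mark E d → ℝ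
  | .inl (a, _) => lam * (Fintype.card V : ℝ) / (Fintype.card W : ℝ) / totalRate V lam /
      (#(serversOf E a.1) : ℝ) ^ d / (Fintype.card (Ranking V) : ℝ)
  | .inr _ => 1 / totalRate V lam

/-- The law of a mark. -/
noncomputable def markLaw (E : Finset (V × W)) (d : ℕ) (lam : ℝ) : Measure (Mark E d) :=
  ∑ ξ, ENNReal.ofReal (markWeight E d lam ξ) • Measure.dirac ξ

lemma totalRate_pos [Nonempty V] {lam : ℝ} (hlam : 0 < lam) : 0 < totalRate V lam := by
  have : 0 < Fintype.card V := Fintype.card_pos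
  unfold totalRate; positivity

lemma markWeight_nonneg [Nonempty V] {lam : ℝ} (hlam : 0 < lam) (ξ : Mark E d) :
    0 ≤ markWeight E d lam ξ := by
  have := totalRate_pos (V := V) hlam
  rcases ξ with ⟨a, σ⟩ | u <;> simp only [markWeight] <;> positivity

lemma markLaw_singleton [Nonempty V] {lam : ℝ} (hlam : 0 < lam) (ξ : Mark E d) :
    (markLaw E d lam).real {ξ} = markWeight E d lam ξ := by
  classical
  rw [measureReal_def, markLaw, Measure.finsetSum_apply, sum_eq_single ξ]
  · simp [ENNReal.toReal_ofReal (markWeight_nonneg hlam ξ)]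
  · intro b _ hb
    simp [hb]
  · simp

lemma sum_markWeight (lam : ℝ) (φ : Mark E d → ℝ) :
    ∑ ξ, markWeight E d lam ξ * φ ξ =
      (∑ w : W, lam * (Fintype.card V : ℝ) / (Fintype.card W : ℝ) *
        ((∑ s : Fin d → serversOf E w, (∑ σ : Ranking V, φ (.inl (⟨w, s⟩, σ))) /
          (Fintype.card (Ranking V) : ℝ)) / (#(serversOf E w) : ℝ) ^ d) +
        ∑ v, φ (.inr v)) / totalRate V lam := by
  have h : ∑ ξ, markWeight E d lam ξ * φ ξ =
      ∑ p : (Σ w : W, (Fin d → serversOf E w)) × Ranking V, markWeight E d lam (.inl p) * φ (.inl p)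
      + ∑ v, markWeight E d lam (.inr v) * φ (.inr v) :=
    Fintype.sum_sum_type fun ξ : ((Σ w : W, (Fin d → serversOf E w)) × Ranking V) ⊕ V =>
      markWeight E d lam ξ * φ ξ
  rw [h, Fintype.sum_prod_type, Fintype.sum_sigma, add_div, sum_div, sum_div]
  congr 1
  · refine sum_congr rfl fun w _ => ?_
    simp only [markWeight]
    rw [sum_div, mul_sum, sum_div]
    refine sum_congr rfl fun s _ => ?_
    rw [← mul_sum]
    ring
  · exact sum_congr rfl fun v _ => by simp only [markWeight]; ring

lemma sum_markWeight_const [Nonempty V] [Nonempty W] {lam : ℝ} (hlam : 0 < lam)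
    (hE : ∀ w, (serversOf E w).Nonempty) : ∑ ξ, markWeight E d lam ξ = 1 := by
  have h := sum_markWeight (E := E) (d := d) lam fun _ => 1
  simp only [mul_one] at h
  rw [h]
  have hr : ((Fintype.card (Ranking V) : ℕ) : ℝ) ≠ 0 := by
    have : Nonempty (Ranking V) := ⟨Fintype.equivFin V⟩
    exact_mod_cast Fintype.card_ne_zero
  have hw : ∀ w : W, (#(serversOf E w) : ℝ) ^ d ≠ 0 := fun w =>
    pow_ne_zero _ (by exact_mod_cast (card_pos.mpr (hE w)).ne')
  have hW : (Fintype.card W : ℝ) ≠ 0 := by exact_mod_cast Fintype.card_ne_zero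
  have hR := (totalRate_pos (V := V) hlam).ne'
  have h1 : ∀ w : W, (∑ s : Fin d → serversOf E w, (∑ σ : Ranking V, (1 : ℝ)) /
          (Fintype.card (Ranking V) : ℝ)) / (#(serversOf E w) : ℝ) ^ d = 1 := by
    intro w
    rw [sum_const, sum_const, card_univ, card_univ, nsmul_one, div_self hr, nsmul_one,
      div_eq_one_iff_eq (hw w)]
    simp
  simp_rw [h1]
  rw [div_eq_one_iff_eq hR, totalRate]
  simp
  field_simp

lemma isProbabilityMeasure_markLaw [Nonempty V] [Nonempty W] {lam : ℝ} (hlam : 0 < lam)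
    (hE : ∀ w, (serversOf E w).Nonempty) : IsProbabilityMeasure (markLaw E d lam) := by
  constructor
  rw [markLaw, Measure.finsetSum_apply]
  simp only [Measure.smul_apply, measure_univ, smul_eq_mul, mul_one]
  rw [← ENNReal.ofReal_sum_of_nonneg fun ξ _ => markWeight_nonneg hlam ξ,
    sum_markWeight_const hlam hE, ENNReal.ofReal_one]

end QueueStep

/-! ### Uniformization of the generator. -/

section Generator

variable {V W : Type} [Fintype V] [DecidableEq V] [Fintype W] [DecidableEq W]

/-- Under a uniformly random ranking every element of `A` is equally likely to come first. -/
lemma sum_ranking_first {A : Finset V} (hA : A.Nonempty) (g : V → ℝ) :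
    (∑ σ : Ranking V, ∑ v ∈ A with ∀ u ∈ A, σ v ≤ σ u, g v) / (Fintype.card (Ranking V) : ℝ)
      = (∑ v ∈ A, g v) / (#A : ℝ) := by
  set c : V → ℕ := fun v => #{σ : Ranking V | ∀ u ∈ A, σ v ≤ σ u} with hc
  have hR : ((Fintype.card (Ranking V) : ℕ) : ℝ) ≠ 0 := by
    have : Nonempty (Ranking V) := ⟨Fintype.equivFin V⟩
    exact_mod_cast Fintype.card_ne_zero
  have hA0 : (#A : ℝ) ≠ 0 := by exact_mod_cast (card_pos.mpr hA).ne'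
  have hsum : ∀ g : V → ℝ, ∑ σ : Ranking V, ∑ v ∈ A with ∀ u ∈ A, σ v ≤ σ u, g v
      = ∑ v ∈ A, (c v : ℝ) * g v := by
    intro g
    simp_rw [sum_filter]
    rw [sum_comm]
    refine sum_congr rfl fun v _ => ?_
    rw [← sum_filter, sum_const, nsmul_eq_mul]
  -- Swapping `u` and `v` maps the rankings with `u` first injectively to those with `v` first, so
  -- all counts agree.
  have hle : ∀ u ∈ A, ∀ v ∈ A, c u ≤ c v := by
    intro u hu v hv
    refine card_le_card_of_injOn (fun σ => (Equiv.swap u v).trans σ) ?_ ?_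
    · intro σ hσ
      simp only [coe_filter, mem_univ, true_and, Set.mem_ofPred_eq, Equiv.trans_apply,
        Equiv.swap_apply_right] at hσ ⊢
      intro z hz
      refine hσ _ ?_
      rw [Equiv.swap_apply_def]
      split_ifs <;> assumption
    · intro σ _ τ _ h
      ext z
      have := congrArg (fun e : Ranking V => e (Equiv.swap u v z)) h
      simpa using congrArg Fin.val this
  obtain ⟨a, ha⟩ := hA
  have hca : ∀ v ∈ A, (c v : ℝ) = c a := fun v hv => by
    exact_mod_cast le_antisymm (hle v hv a ha) (hle a ha v hv)
  have htot : (#A : ℝ) * c a = Fintype.card (Ranking V) := by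
    have h1 := hsum fun _ => 1
    have h2 : ∀ σ : Ranking V, ∑ v ∈ A with ∀ u ∈ A, σ v ≤ σ u, (1 : ℝ) = 1 := by
      intro σ
      obtain ⟨v, hv⟩ := exists_first ⟨a, ha⟩ σ
      rw [hv, sum_singleton]
    rw [sum_congr rfl fun σ _ => h2 σ, sum_const, card_univ, nsmul_one,
      sum_congr rfl fun v hv => by rw [mul_one, hca v hv], sum_const, nsmul_eq_mul] at h1
    exact h1.symm
  rw [hsum, sum_congr rfl fun v hv => by rw [hca v hv], ← mul_sum, ← htot]
  have hca0 : (c a : ℝ) ≠ 0 := fun h => hR (by rw [← htot, h, mul_zero])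
  field_simp

variable {E : Finset (V × W)} {d : ℕ}

/-- A uniform ranking breaks ties uniformly, so averaging over samples and rankings recovers
`assignProb`. The term `f x` is split off because exactly one server is joined. -/
lemma average_arrival (hd : 0 < d) (hE : ∀ w, (serversOf E w).Nonempty) (f : State V → ℝ)
    (x : State V) (w : W) :
    (∑ s : Fin d → serversOf E w, (∑ σ : Ranking V, f (queueStep x (.inl (⟨w, s⟩, σ) : Mark E d))) /
      (Fintype.card (Ranking V) : ℝ)) / (#(serversOf E w) : ℝ) ^ d
      = ∑ v, assignProb E d x w v * (f (Function.update x v (x v + 1)) - f x) + f x := by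
  have hw : (#(serversOf E w) : ℝ) ^ d ≠ 0 :=
    pow_ne_zero _ (by exact_mod_cast (card_pos.mpr (hE w)).ne')
  have h1 : ∀ s : Fin d → serversOf E w,
      (∑ σ : Ranking V, f (queueStep x (.inl (⟨w, s⟩, σ) : Mark E d))) /
      (Fintype.card (Ranking V) : ℝ)
      = ∑ v, (if v ∈ shortest x s then 1 / (#(shortest x s) : ℝ) else 0) *
        (f (Function.update x v (x v + 1)) - f x) + f x := by
    intro s
    have h2 : ∀ σ : Ranking V, f (queueStep x (.inl (⟨w, s⟩, σ) : Mark E d))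
        = ∑ v ∈ shortest x s with ∀ u ∈ shortest x s, σ v ≤ σ u,
          f (Function.update x v (x v + 1)) := by
      intro σ
      obtain ⟨v, hv⟩ := exists_joined hd x s σ
      rw [queueStep_arrival (a := ⟨w, s⟩) hv]
      unfold joined at hv
      rw [hv, sum_singleton]
    have hne := shortest_nonempty hd x s
    have hcard : (#(shortest x s) : ℝ) ≠ 0 := by exact_mod_cast (card_pos.mpr hne).ne'
    simp_rw [h2]
    rw [sum_ranking_first hne]
    simp only [ite_mul, zero_mul]
    rw [← sum_filter, filter_univ_mem, ← mul_sum, sum_sub_distrib, sum_const, nsmul_eq_mul]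
    field_simp
    ring
  simp_rw [h1]
  rw [sum_add_distrib, sum_const, card_univ, add_div]
  congr 1
  · rw [sum_comm, sum_div]
    refine sum_congr rfl fun v _ => ?_
    rw [assignProb, ← sum_mul]
    ring
  · simp only [Fintype.card_fun, Fintype.card_coe, Fintype.card_fin, nsmul_eq_mul, Nat.cast_pow]
    field_simp

lemma generator_eq [Nonempty V] [Nonempty W] (hd : 0 < d) (hE : ∀ w, (serversOf E w).Nonempty)
    {lam : ℝ} (hlam : 0 < lam) (f : State V → ℝ) :
    generator E d lam f
      = fun x => totalRate V lam * (stepOp queueStep (markLaw E d lam) f x - f x) := by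
  funext x
  have hR := (totalRate_pos (V := V) hlam).ne'
  have hW : (Fintype.card W : ℝ) ≠ 0 := by exact_mod_cast Fintype.card_ne_zero
  have h : stepOp queueStep (markLaw E d lam) f x
      = ∑ ξ, markWeight E d lam ξ * f (queueStep x ξ) :=
    sum_congr rfl fun ξ _ => by rw [markLaw_singleton hlam]
  rw [h, sum_markWeight lam fun ξ => f (queueStep x ξ)]
  simp_rw [average_arrival hd hE f x]
  have h2 : ∀ v, f (queueStep x (.inr v : Mark E d)) =
      (if 0 < x v then f (Function.update x v (x v - 1)) - f x else 0) + f x := by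
    intro v
    simp only [queueStep]
    split_ifs with h0
    · ring
    · have : x v - 1 = x v := by omega
      rw [this, Function.update_eq_self, zero_add]
  simp_rw [h2, mul_add, sum_add_distrib, sum_const, nsmul_eq_mul, card_univ]
  rw [generator, mul_sub, mul_div_cancel₀ _ hR, totalRate]
  field_simp
  ring

/-- The binomial theorem for `r (K - 1)`, where the one-step operator `K` commutes with `-1`. -/
lemma generator_iterate [Nonempty V] [Nonempty W] (hd : 0 < d)
    (hE : ∀ w, (serversOf E w).Nonempty) {lam : ℝ} (hlam : 0 < lam) (f : State V → ℝ) (n : ℕ)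
    (x : State V) :
    ((generator E d lam)^[n] f) x = totalRate V lam ^ n * ∑ m ∈ antidiagonal n,
      (n.choose m.1 : ℝ) * (((stepOp queueStep (markLaw E d lam))^[m.1] f) x * (-1) ^ m.2) := by
  let K : Module.End ℝ (State V → ℝ) :=
    { toFun := stepOp queueStep (markLaw E d lam)
      map_add' := fun f g => by
        funext z; simp [stepOp, mul_add, sum_add_distrib]
      map_smul' := fun c f => by
        funext z
        simp only [stepOp, Pi.smul_apply, smul_eq_mul, mul_sum, RingHom.id_apply]
        exact sum_congr rfl fun ξ _ => by ring }
  have hK : ∀ k, ((stepOp queueStep (markLaw E d lam))^[k] f) = (K ^ k) f := fun k => by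
    rw [Module.End.pow_apply]; rfl
  have hL : (generator E d lam)^[n] f = (((totalRate V lam) • (K + (-1))) ^ n) f := by
    rw [Module.End.pow_apply]
    congr 1
    funext g x
    rw [generator_eq hd hE hlam]
    simp [K, sub_eq_add_neg]
    ring
  rw [hL, smul_pow, (Commute.neg_one_right K).add_pow']
  simp only [LinearMap.smul_apply, LinearMap.sum_apply, Pi.smul_apply, smul_eq_mul,
    Finset.sum_apply]
  congr 1
  refine sum_congr rfl fun m _ => ?_
  rw [hK]
  rcases Nat.even_or_odd m.2 with h | h
  · simp [h.neg_one_pow]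
  · simp [h.neg_one_pow]

/-- This is `e^{tr(K - 1)} = e^{-rt} e^{trK}`, obtained as the Cauchy product of the series in `K`
with the scalar series of `e^{-rt}`. -/
lemma transition_eq [Nonempty V] [Nonempty W] (hd : 0 < d) (hE : ∀ w, (serversOf E w).Nonempty)
    {lam : ℝ} (hlam : 0 < lam) (t : ℝ) (x y : State V) :
    transition E d lam t x y
      = jumpTransition (totalRate V lam) (markLaw E d lam) queueStep t x y := by
  have := isProbabilityMeasure_markLaw (d := d) hlam hE
  set f : State V → ℝ := ({y} : Set (State V)).indicator 1 with hf
  have hf' : (fun z : State V => if z = y then (1 : ℝ) else 0) = f := by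
    funext z; simp only [hf, Set.indicator_apply, Set.mem_singleton_iff, Pi.one_apply]
  set a : ℕ → ℝ := fun k => ((stepOp queueStep (markLaw E d lam))^[k] f) x with ha
  have ha0 : ∀ k, 0 ≤ a k := fun k =>
    stepOp_iterate_nonneg _ _ (Set.indicator_nonneg fun _ _ => zero_le_one) k x
  have ha1 : ∀ k, a k ≤ 1 := fun k =>
    stepOp_iterate_le_const _ _ (Set.indicator_le_self' fun _ _ => zero_le_one) k x
  set r := totalRate V lam
  have hs1 : Summable fun k => ‖(r * t) ^ k / (k.factorial : ℝ) * a k‖ := by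
    refine Summable.of_nonneg_of_le (fun _ => norm_nonneg _) (fun k => ?_)
      (NormedSpace.norm_expSeries_div_summable (r * t))
    rw [norm_mul, Real.norm_of_nonneg (ha0 k)]
    exact mul_le_of_le_one_right (norm_nonneg _) (ha1 k)
  have hs2 := NormedSpace.norm_expSeries_div_summable (-(r * t))
  have hexp : Real.exp (-(r * t)) = ∑' j : ℕ, (-(r * t)) ^ j / (j.factorial : ℝ) := by
    rw [Real.exp_eq_exp_ℝ, NormedSpace.exp_eq_tsum_div]
  have hprod := tsum_mul_tsum_eq_tsum_sum_antidiagonal_of_summable_norm hs1 hs2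
  rw [← hexp] at hprod
  have hj : jumpTransition r (markLaw E d lam) queueStep t x y
      = (∑' k : ℕ, (r * t) ^ k / (k.factorial : ℝ) * a k) * Real.exp (-(r * t)) := by
    rw [mul_comm, ← tsum_mul_left]
    exact tsum_congr fun k => by rw [poissonWeight, mul_assoc]
  rw [hj, hprod, transition, hf']
  refine tsum_congr fun n => ?_
  rw [generator_iterate hd hE hlam, mul_sum, mul_sum]
  refine sum_congr rfl fun m hm => ?_
  rw [← mem_antidiagonal.mp hm, Nat.cast_add_choose]
  have h1 : ((m.1.factorial : ℕ) : ℝ) ≠ 0 := by positivity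
  have h2 : ((m.2.factorial : ℕ) : ℝ) ≠ 0 := by positivity
  have h3 : (((m.1 + m.2).factorial : ℕ) : ℝ) ≠ 0 := by positivity
  rw [neg_pow (r * t) m.2]
  simp only [ha]
  field_simp
  ring

end Generator

/-! ### Decay of Poisson mixtures through a differential inequality. -/

section PoissonMixture

lemma hasDerivAt_tsum_pow_div_factorial {u : ℕ → ℝ} {B : ℝ} (hu : ∀ n, |u n| ≤ B) (x : ℝ) :
    HasDerivAt (fun y : ℝ => ∑' n : ℕ, y ^ n / (n.factorial : ℝ) * u n)
      (∑' n : ℕ, x ^ n / (n.factorial : ℝ) * u (n + 1)) x := by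
  set R : ℝ := |x| + 1
  have hR : 0 ≤ R := by positivity
  have hB : 0 ≤ B := (abs_nonneg _).trans (hu 0)
  set g' : ℕ → ℝ → ℝ := fun n y => (n * y ^ (n - 1)) / (n.factorial : ℝ) * u n with hg'
  have hsucc : ∀ n y, g' (n + 1) y = y ^ n / (n.factorial : ℝ) * u (n + 1) := by
    intro n y
    simp only [hg', Nat.factorial_succ, Nat.add_sub_cancel]
    have : ((n.factorial : ℕ) : ℝ) ≠ 0 := by positivity
    push_cast
    field_simp
  have hsum : ∀ y : ℝ, Summable fun n : ℕ => y ^ n / (n.factorial : ℝ) := fun y =>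
    NormedSpace.expSeries_div_summable y
  have hmem : ∀ y ∈ Set.Ioo (-R) R, |y| ≤ R := fun y hy => (abs_lt.mpr hy).le
  have hx : x ∈ Set.Ioo (-R) R := abs_lt.mp (lt_add_one _)
  have hbd : ∀ (v : ℕ → ℝ), (∀ n, |v n| ≤ B) → ∀ n y, |y| ≤ R →
      ‖y ^ n / (n.factorial : ℝ) * v n‖ ≤ R ^ n / (n.factorial : ℝ) * B := by
    intro v hv n y hy
    rw [norm_mul, norm_div, norm_pow, Real.norm_natCast, Real.norm_eq_abs, Real.norm_eq_abs]
    exact mul_le_mul (div_le_div_of_nonneg_right (pow_le_pow_left₀ (abs_nonneg _) hy n)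
      (by positivity)) (hv n) (abs_nonneg _) (by positivity)
  have key := hasDerivAt_tsum_of_isPreconnected (𝕜 := ℝ)
    -- The dominating series is shifted by one, because the derivative of the constant term
    -- vanishes.
    (u := fun n : ℕ => if n = 0 then 0 else R ^ (n - 1) / ((n - 1).factorial : ℝ) * B)
    (g := fun n y => y ^ n / (n.factorial : ℝ) * u n) (g' := g') (t := Set.Ioo (-R) R)
    (y₀ := x) (y := x) ?_ isOpen_Ioo isPreconnected_Ioo ?_ ?_ hx ?_ hx
  · rw [tsum_eq_zero_add'] at key
    · have h0 : g' 0 x = 0 := by simp [hg']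
      simp_rw [hsucc, h0, zero_add] at key
      exact key
    · simp_rw [hsucc]
      exact Summable.of_norm_bounded ((hsum R).mul_right B)
        fun n => hbd _ (fun n => hu (n + 1)) n x (hmem x hx)
  · rw [← summable_nat_add_iff 1]
    simpa using (hsum R).mul_right B
  · intro n y _
    exact ((hasDerivAt_pow n y).div_const _).mul_const _
  · intro n y hy
    cases n with
    | zero => simp [hg']
    | succ n =>
      rw [hsucc]
      simpa using hbd _ (fun n => hu (n + 1)) n y (hmem y hy)
  · exact Summable.of_norm_bounded ((hsum R).mul_right B)
      fun n => hbd _ hu n x (hmem x hx)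

lemma hasDerivAt_poissonMixture {u : ℕ → ℝ} {B : ℝ} (hu : ∀ n, |u n| ≤ B) (r t : ℝ) :
    HasDerivAt (fun t => ∑' n, poissonWeight r t n * u n)
      (∑' n, poissonWeight r t n * (r * (u (n + 1) - u n))) t := by
  have hfac : ∀ (v : ℕ → ℝ) (t : ℝ), ∑' n, poissonWeight r t n * v n
      = Real.exp (-(r * t)) * ∑' n : ℕ, (r * t) ^ n / (n.factorial : ℝ) * v n := by
    intro v t
    rw [← tsum_mul_left]
    exact tsum_congr fun n => by rw [poissonWeight, mul_assoc]
  have hsum : ∀ v : ℕ → ℝ, (∀ n, |v n| ≤ B) →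
      Summable fun n : ℕ => (r * t) ^ n / (n.factorial : ℝ) * v n := by
    intro v hv
    refine Summable.of_norm_bounded
      ((NormedSpace.norm_expSeries_div_summable (r * t)).mul_right B) fun n => ?_
    rw [norm_mul]
    exact mul_le_mul_of_nonneg_left (hv n) (norm_nonneg _)
  simp_rw [hfac]
  have h1 : HasDerivAt (fun t : ℝ => r * t) (r * 1) t := (hasDerivAt_id t).const_mul r
  have h2 := (hasDerivAt_tsum_pow_div_factorial hu (r * t)).comp t h1
  convert! h1.neg.exp.mul h2 using 1
  have h3 : ∑' n : ℕ, (r * t) ^ n / (n.factorial : ℝ) * (r * (u (n + 1) - u n))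
      = r * (∑' n : ℕ, (r * t) ^ n / (n.factorial : ℝ) * u (n + 1)) -
        r * ∑' n : ℕ, (r * t) ^ n / (n.factorial : ℝ) * u n := by
    rw [← tsum_mul_left, ← tsum_mul_left, ← Summable.tsum_sub
      ((hsum _ fun n => hu (n + 1)).mul_left r) ((hsum _ hu).mul_left r)]
    exact tsum_congr fun n => by ring
  rw [h3]
  simp only [Function.comp, Pi.neg_apply]
  ring

/-- A Poisson mixture of a sequence that obeys a superlinear recursive decay decays polynomially in
time, at a speed that does not depend on the rate of the Poisson process. -/
lemma poissonMixture_le {m : ℕ} (hm : 0 < m) {C : ℝ} (hC : 1 ≤ C) {r : ℝ} (hr : 0 < r)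
    {u : ℕ → ℝ} (h0 : ∀ n, 0 ≤ u n) (h1 : ∀ n, u n ≤ C)
    (hrec : ∀ n, ∀ ε : ℝ, 0 < ε → ε ≤ 1 →
      r * (u (n + 1) - u n) ≤ -(1 / 2 * ε ^ m * (u n - ε * C))) {t : ℝ} (ht : 0 ≤ t) :
    ∑' n, poissonWeight r t n * u n
      ≤ 1 / ((C ^ m)⁻¹ + m / (8 * (2 * C) ^ m) * t) ^ (1 / (m : ℝ)) := by
  have hu : ∀ n, |u n| ≤ C := fun n => by rw [abs_of_nonneg (h0 n)]; exact h1 n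
  have hC0 : 0 < C := by linarith
  have hm' : (0 : ℝ) < m := by exact_mod_cast hm
  -- `c₁` gives the barrier `φ` the initial value `C`, and `c₂` makes it solve `φ' = -φ ^ (m + 1) /
  -- (8 (2C) ^ m)`.
  set c₁ : ℝ := (C ^ m)⁻¹ with hc₁
  set c₂ : ℝ := m / (8 * (2 * C) ^ m) with hc₂
  have hc1 : 0 < c₁ := by positivity
  have hc2 : 0 < c₂ := by positivity
  set U : ℝ → ℝ := fun t => ∑' n, poissonWeight r t n * u n with hU
  set φ : ℝ → ℝ := fun t => (c₁ + c₂ * t) ^ (-(1 / (m : ℝ))) with hφ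
  have hpos : ∀ s, 0 ≤ s → 0 < c₁ + c₂ * s := fun s hs => by positivity
  have hφpos : ∀ s, 0 ≤ s → 0 < φ s := fun s hs => Real.rpow_pos_of_pos (hpos s hs) _
  have hφm : ∀ s, 0 ≤ s → φ s ^ m = (c₁ + c₂ * s)⁻¹ := by
    intro s hs
    rw [hφ]
    simp only
    rw [← Real.rpow_natCast, ← Real.rpow_mul (hpos s hs).le, neg_mul,
      one_div_mul_cancel hm'.ne', Real.rpow_neg_one]
  have hφ0 : φ 0 = C := by
    have h2 := hφm 0 le_rfl
    rw [mul_zero, add_zero, hc₁, inv_inv] at h2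
    exact (pow_left_inj₀ (hφpos 0 le_rfl).le hC0.le hm.ne').mp h2
  have hφC : ∀ s, 0 ≤ s → φ s ≤ C := by
    intro s hs
    refine le_of_pow_le_pow_left₀ hm.ne' hC0.le ?_
    rw [hφm s hs, inv_le_comm₀ (hpos s hs) (by positivity)]
    have : 0 ≤ c₂ * s := by positivity
    linarith
  have hder : ∀ s, HasDerivAt U (∑' n, poissonWeight r s n * (r * (u (n + 1) - u n))) s :=
    hasDerivAt_poissonMixture hu r
  have hφder : ∀ s, 0 ≤ s → HasDerivAt φ (-(c₂ / m) * (φ s * φ s ^ m)) s := by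
    intro s hs
    have h2 : HasDerivAt (fun s => c₁ + c₂ * s) (c₂ * 1) s :=
      ((hasDerivAt_id s).const_mul c₂).const_add c₁
    convert! h2.rpow_const (p := -(1 / (m : ℝ))) (Or.inl (hpos s hs).ne') using 1
    rw [hφm s hs, Real.rpow_sub_one (hpos s hs).ne']
    simp only [hφ]
    field_simp
  have hsumm : ∀ s, 0 ≤ s → ∀ v : ℕ → ℝ, (∀ n, |v n| ≤ C) →
      Summable fun n => poissonWeight r s n * v n := by
    intro s hs v hv
    refine Summable.of_norm_bounded ((hasSum_poissonWeight r s).summable.mul_right C) fun n => ?_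
    rw [norm_mul, Real.norm_of_nonneg (poissonWeight_nonneg hr.le hs n)]
    exact mul_le_mul_of_nonneg_left (hv n) (poissonWeight_nonneg hr.le hs n)
  have hbound : ∀ s, 0 ≤ s → U s = φ s →
      ∑' n, poissonWeight r s n * (r * (u (n + 1) - u n)) < -(c₂ / m) * (φ s * φ s ^ m) := by
    intro s hs hUs
    -- With this choice `ε * C` is half of `U s = φ s`. The decay rate obtained has constant `1 / 4`
    -- against the barrier's `1 / 8`, which leaves the strict inequality that the comparison needs
    -- at contact points.
    set ε := φ s / (2 * C) with hε
    have hε0 : 0 < ε := by have := hφpos s hs; positivity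
    have hε1 : ε ≤ 1 := by
      rw [hε, div_le_one (by positivity)]; linarith [hφC s hs]
    have h2 : ∑' n, poissonWeight r s n * (r * (u (n + 1) - u n))
        ≤ -(1 / 2 * ε ^ m * (U s - ε * C)) := by
      have h3 : HasSum (fun n => poissonWeight r s n * -(1 / 2 * ε ^ m * (u n - ε * C)))
          (-(1 / 2 * ε ^ m * (U s - ε * C))) := by
        have h4 := (((hsumm s hs u hu).hasSum.sub
          ((hasSum_poissonWeight r s).mul_right (ε * C))).mul_left (-(1 / 2 * ε ^ m)))
        convert! h4 using 1
        · funext n; ring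
        · simp only [hU]; ring
      have h5 : Summable fun n => poissonWeight r s n * (r * (u (n + 1) - u n)) := by
        have h6 := ((hsumm s hs (fun n => u (n + 1)) fun n => hu (n + 1)).sub
          (hsumm s hs u hu)).mul_left r
        exact h6.congr fun n => by ring
      rw [← h3.tsum_eq]
      exact h5.tsum_le_tsum (fun n => mul_le_mul_of_nonneg_left (hrec n ε hε0 hε1)
        (poissonWeight_nonneg hr.le hs n)) h3.summable
    refine h2.trans_lt ?_
    have h6 : ε * C = φ s / 2 := by rw [hε]; field_simp
    have h7 : ε ^ m = φ s ^ m / (2 * C) ^ m := by rw [hε, div_pow]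
    have h8 : c₂ / m = 1 / (8 * (2 * C) ^ m) := by rw [hc₂]; field_simp
    rw [h6, h7, h8, hUs]
    have h9 : 0 < φ s * φ s ^ m / (2 * C) ^ m := by have := hφpos s hs; positivity
    have e1 : -(1 / 2 * (φ s ^ m / (2 * C) ^ m) * (φ s - φ s / 2))
        = -(1 / 4) * (φ s * φ s ^ m / (2 * C) ^ m) := by ring
    have e2 : -(1 / (8 * (2 * C) ^ m)) * (φ s * φ s ^ m)
        = -(1 / 8) * (φ s * φ s ^ m / (2 * C) ^ m) := by field_simp
    rw [e1, e2]
    linarith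
  have hU0 : U 0 ≤ φ 0 := by
    rw [hφ0]
    have h2 := ((hsumm 0 le_rfl u hu).tsum_le_tsum (fun n => mul_le_mul_of_nonneg_left (h1 n)
      (poissonWeight_nonneg hr.le le_rfl n)) ((hasSum_poissonWeight r 0).summable.mul_right C))
    rwa [((hasSum_poissonWeight r 0).mul_right C).tsum_eq, one_mul] at h2
  have hfinal := image_le_of_deriv_right_lt_deriv_boundary' (a := 0) (b := t)
    (fun s _ => (hder s).continuousAt.continuousWithinAt)
    (fun s _ => (hder s).hasDerivWithinAt) hU0
    (fun s hs => (hφder s hs.1).continuousAt.continuousWithinAt)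
    (fun s hs => (hφder s hs.1).hasDerivWithinAt) (fun s hs => hbound s hs.1)
    (Set.right_mem_Icc.mpr ht)
  rw [one_div, ← Real.rpow_neg (hpos t ht).le]
  exact hfinal

end PoissonMixture

/-! ### Drift estimates for exponential moments and for the coupling. -/

section Drift

/-- The drift bound for the coupling is available only on ordered pairs, a set that every event
preserves. -/
lemma stepOp_iterate_mono_on {S Ξ : Type} [MeasurableSpace Ξ] [Fintype Ξ] (ν : Measure Ξ)
    (step : S → Ξ → S) {p : S → Prop} (hp : ∀ z ξ, p z → p (step z ξ)) {f g : S → ℝ}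
    (h : ∀ z, p z → f z ≤ g z) (k : ℕ) {z : S} (hz : p z) :
    ((stepOp step ν)^[k] f) z ≤ ((stepOp step ν)^[k] g) z := by
  induction k generalizing z with
  | zero => exact h z hz
  | succ k ih =>
    simp only [Function.iterate_succ_apply']
    exact sum_le_sum fun ξ _ => mul_le_mul_of_nonneg_left (ih (hp z ξ hz)) measureReal_nonneg

lemma stepOp_affine {S Ξ : Type} [MeasurableSpace Ξ] [Fintype Ξ] [MeasurableSingletonClass Ξ]
    (ν : Measure Ξ) [IsProbabilityMeasure ν] (step : S → Ξ → S) (f : S → ℝ) (a c : ℝ) (z : S) :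
    stepOp step ν (fun z => a * f z + c) z = a * stepOp step ν f z + c := by
  have h := sum_measureReal_singleton ν
  simp only [stepOp, mul_add, sum_add_distrib, ← sum_mul, h, one_mul, mul_sum]
  congr 1
  exact sum_congr rfl fun ξ _ => by ring

lemma stepOp_iterate_le_of_contraction {S Ξ : Type} [MeasurableSpace Ξ] [Fintype Ξ]
    [MeasurableSingletonClass Ξ] (ν : Measure Ξ) [IsProbabilityMeasure ν] (step : S → Ξ → S)
    {f : S → ℝ} {a C : ℝ} (ha : 0 ≤ a) (h : ∀ z, stepOp step ν f z ≤ a * f z + (1 - a) * C)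
    (k : ℕ) (z : S) : ((stepOp step ν)^[k] f) z ≤ a ^ k * f z + (1 - a ^ k) * C := by
  induction k generalizing z with
  | zero => simp
  | succ k ih =>
    rw [Function.iterate_succ_apply']
    refine (stepOp_mono ν step ih z).trans ?_
    rw [stepOp_affine]
    have := mul_le_mul_of_nonneg_left (h z) (pow_nonneg ha k)
    refine (add_le_add_left this _).trans_eq ?_
    ring

variable {V W : Type} [Fintype V] [DecidableEq V] [Fintype W] [DecidableEq W]
  {E : Finset (V × W)} {d : ℕ}

lemma sum_sample {α : Type*} [Fintype α] [DecidableEq α] [Nonempty α] (j : Fin d) (g : α → ℝ) :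
    (∑ s : Fin d → α, g (s j)) / (Fintype.card α : ℝ) ^ d
      = (∑ v, g v) / (Fintype.card α : ℝ) := by
  have hα : (Fintype.card α : ℝ) ≠ 0 := by exact_mod_cast Fintype.card_ne_zero
  -- The sum over samples factorizes over coordinates, and every coordinate other than `j`
  -- contributes only the cardinality.
  have h := prod_univ_sum (fun _ : Fin d => (univ : Finset α))
    (fun i a => if i = j then g a else (1 : ℝ))
  rw [Fintype.piFinset_univ] at h
  have h1 : ∀ s : Fin d → α, ∏ i, (if i = j then g (s i) else 1) = g (s j) := by
    intro s
    rw [prod_ite_eq' univ j fun i => g (s i), if_pos (mem_univ _)]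
  simp_rw [h1] at h
  have h2 : ∀ i : Fin d, ∑ a : α, (if i = j then g a else 1)
      = Fintype.card α * (if i = j then (∑ a, g a) / Fintype.card α else 1) := by
    intro i
    split_ifs
    · field_simp
    · simp
  simp_rw [h2] at h
  rw [prod_mul_distrib, prod_const, card_univ, Fintype.card_fin,
    prod_ite_eq' univ j fun _ => (∑ a, g a) / (Fintype.card α : ℝ), if_pos (mem_univ _)] at h
  rw [← h]
  field_simp

/-- Each sampled server is uniform on its neighbourhood. After exchanging the sums, the coefficient
of `g v` is the load of `v`, which `maxLoad` bounds. -/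
lemma sum_sampled_le [Nonempty V] (hE : ∀ w, (serversOf E w).Nonempty) {lam ρ : ℝ}
    (hload : maxLoad E lam ≤ ρ) {g : V → ℝ} (hg : ∀ v, 0 ≤ g v) (j : Fin d) :
    ∑ w : W, lam * (Fintype.card V : ℝ) / (Fintype.card W : ℝ) *
      ((∑ s : Fin d → serversOf E w, g (s j)) / (#(serversOf E w) : ℝ) ^ d) ≤ ρ * ∑ v, g v := by
  have h1 : ∀ w, (∑ s : Fin d → serversOf E w, g (s j)) / (#(serversOf E w) : ℝ) ^ d
      = ∑ v, if v ∈ serversOf E w then g v * (1 / (#(serversOf E w) : ℝ)) else 0 := by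
    intro w
    have : Nonempty (serversOf E w) := (hE w).to_subtype
    have h := sum_sample j fun v : serversOf E w => g v
    rw [Fintype.card_coe] at h
    rw [h, sum_coe_sort (serversOf E w) g, sum_div, ← sum_filter, filter_univ_mem]
    exact sum_congr rfl fun v _ => by ring
  simp_rw [h1, mul_sum]
  rw [sum_comm]
  refine sum_le_sum fun v _ => ?_
  have h2 : ∑ w : W, lam * (Fintype.card V : ℝ) / (Fintype.card W : ℝ) *
      (if v ∈ serversOf E w then g v * (1 / (#(serversOf E w) : ℝ)) else 0)
      = (lam * (Fintype.card V : ℝ) / (Fintype.card W : ℝ) *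
        ∑ w ∈ typesOf E v, 1 / (#(serversOf E w) : ℝ)) * g v := by
    rw [mul_sum, sum_mul]
    have : typesOf E v = univ.filter fun w => v ∈ serversOf E w := by
      ext w; simp [typesOf, serversOf]
    rw [this, sum_filter]
    refine sum_congr rfl fun w _ => ?_
    split_ifs <;> ring
  rw [h2]
  exact mul_le_mul_of_nonneg_right ((le_sup' (fun v : V =>
    lam * (Fintype.card V : ℝ) / (Fintype.card W : ℝ) *
      ∑ w ∈ typesOf E v, 1 / (#(serversOf E w) : ℝ)) (mem_univ v)).trans hload) (hg v)

/-- An upper bound for the drift of a function, from bounds for its increments. -/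
lemma sum_markWeight_le [Nonempty V] [Nonempty W] (hE : ∀ w, (serversOf E w).Nonempty) {lam ρ : ℝ}
    (hlam : 0 < lam) (hload : maxLoad E lam ≤ ρ) {φ : Mark E d → ℝ} {c : ℝ} {D g : V → ℝ}
    (hg : ∀ v, 0 ≤ g v) (J : Finset (Fin d))
    (h1 : ∀ a σ, φ (.inl (a, σ)) ≤ c + ∑ j ∈ J, g (a.2 j)) (h2 : ∀ v, φ (.inr v) ≤ c + D v) :
    ∑ ξ, (markLaw E d lam).real {ξ} * φ ξ
      ≤ c + (#J * (ρ * ∑ v, g v) + ∑ v, D v) / totalRate V lam := by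
  have hR := totalRate_pos (V := V) hlam
  set ψ : Mark E d → ℝ := fun ξ => match ξ with
    | .inl (a, _) => ∑ j ∈ J, g (a.2 j)
    | .inr v => D v with hψ
  have h3 : ∀ ξ, φ ξ ≤ c + ψ ξ := by
    rintro (⟨a, σ⟩ | v)
    · exact h1 a σ
    · exact h2 v
  have hr : ((Fintype.card (Ranking V) : ℕ) : ℝ) ≠ 0 := by
    have : Nonempty (Ranking V) := ⟨Fintype.equivFin V⟩
    exact_mod_cast Fintype.card_ne_zero
  calc ∑ ξ, (markLaw E d lam).real {ξ} * φ ξ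
      ≤ ∑ ξ, markWeight E d lam ξ * (c + ψ ξ) := sum_le_sum fun ξ _ => by
        rw [markLaw_singleton hlam]
        exact mul_le_mul_of_nonneg_left (h3 ξ) (markWeight_nonneg hlam ξ)
    _ = c + ∑ ξ, markWeight E d lam ξ * ψ ξ := by
        simp_rw [mul_add]
        rw [sum_add_distrib, ← sum_mul, sum_markWeight_const hlam hE, one_mul]
    _ ≤ _ := by
        rw [sum_markWeight]
        refine add_le_add le_rfl (div_le_div_of_nonneg_right (add_le_add ?_ le_rfl) hR.le)
        have h4 : ∀ w, (∑ s : Fin d → serversOf E w,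
            (∑ σ : Ranking V, ψ (.inl (⟨w, s⟩, σ))) / (Fintype.card (Ranking V) : ℝ)) /
            (#(serversOf E w) : ℝ) ^ d
            = ∑ j ∈ J, (∑ s : Fin d → serversOf E w, g (s j)) / (#(serversOf E w) : ℝ) ^ d := by
          intro w
          rw [← sum_div J, sum_comm (s := J)]
          congr 1
          refine sum_congr rfl fun s _ => ?_
          simp only [hψ, sum_const, card_univ, nsmul_eq_mul]
          field_simp
        rw [sum_congr rfl fun w _ => by rw [h4 w, mul_sum], sum_comm, ← nsmul_eq_mul]
        exact sum_le_card_nsmul _ _ _ fun j _ => sum_sampled_le hE hload hg j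

/-- The exponential moment function. -/
noncomputable def expSum (θ : ℝ) (x : State V) : ℝ := ∑ v, θ ^ x v

/-- The queue joined is no longer than the first sampled one, so an arrival costs at most what
uniform routing would. A departure multiplies `θ ^ x v` by `1 / θ` unless the queue is empty, and
the term in `Fintype.card V` compensates for empty queues. -/
lemma stepOp_expSum_le [Nonempty V] [Nonempty W] (hd : 0 < d)
    (hE : ∀ w, (serversOf E w).Nonempty) {lam ρ θ : ℝ} (hlam : 0 < lam)
    (hload : maxLoad E lam ≤ ρ) (hθ : 1 < θ) (x : State V) :
    stepOp queueStep (markLaw E d lam) (expSum θ) x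
      ≤ expSum θ x + ((1 - 1 / θ) * Fintype.card V
        - ((1 - 1 / θ) - ρ * (θ - 1)) * expSum θ x) / totalRate V lam := by
  have hθ0 : 0 < θ := by linarith
  have h := sum_markWeight_le (d := d) hE hlam hload
    (φ := fun ξ => expSum θ (queueStep x ξ)) (c := expSum θ x)
    (D := fun v => (1 - 1 / θ) - (1 - 1 / θ) * θ ^ x v)
    (g := fun v => (θ - 1) * θ ^ x v) (fun v => mul_nonneg (by linarith) (by positivity))
    {⟨0, hd⟩} ?_ ?_
  · refine h.trans_eq ?_
    congr 2
    simp only [card_singleton, Nat.cast_one, one_mul, sum_sub_distrib, sum_const, card_univ,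
      nsmul_eq_mul, ← mul_sum]
    rw [← expSum]
    ring
  · intro a σ
    obtain ⟨v, hv⟩ := exists_joined hd x a.2 σ
    have hs := mem_shortest.mp (joined_subset (hv ▸ mem_singleton_self v))
    rw [sum_singleton, queueStep_arrival hv, expSum, expSum, ← add_sum_erase univ _ (mem_univ v),
      ← add_sum_erase univ (fun u => θ ^ x u) (mem_univ v), Function.update_self]
    have h1 : ∑ u ∈ univ.erase v, θ ^ Function.update x v (x v + 1) u
        = ∑ u ∈ univ.erase v, θ ^ x u :=
      sum_congr rfl fun u hu => by rw [Function.update_of_ne (ne_of_mem_erase hu)]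
    have h2 : θ ^ x v ≤ θ ^ x (a.2 ⟨0, hd⟩) := pow_le_pow_right₀ hθ.le (hs.2 _)
    have h3 := mul_le_mul_of_nonneg_left h2 (sub_nonneg.mpr hθ.le)
    rw [h1, pow_succ]
    linarith
  · intro v
    simp only [queueStep]
    rw [expSum, expSum, ← add_sum_erase univ _ (mem_univ v),
      ← add_sum_erase univ (fun u => θ ^ x u) (mem_univ v), Function.update_self]
    have h1 : ∑ u ∈ univ.erase v, θ ^ Function.update x v (x v - 1) u
        = ∑ u ∈ univ.erase v, θ ^ x u :=
      sum_congr rfl fun u hu => by rw [Function.update_of_ne (ne_of_mem_erase hu)]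
    rw [h1]
    rcases Nat.eq_zero_or_pos (x v) with h0 | h0
    · simp [h0]
    · obtain ⟨k, hk⟩ : ∃ k, x v = k + 1 := ⟨x v - 1, by omega⟩
      have h2 : 0 ≤ 1 - 1 / θ := by
        rw [sub_nonneg, div_le_one hθ0]; exact hθ.le
      rw [hk, Nat.add_sub_cancel, pow_succ]
      have h3 : (1 - 1 / θ) * (θ ^ k * θ) = θ ^ k * θ - θ ^ k := by field_simp
      linarith

/-- Two systems driven by the same events. -/
def pairStep (z : State V × State V) (ξ : Mark E d) : State V × State V :=
  (queueStep z.1 ξ, queueStep z.2 ξ)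

/-- The total number of tasks by which the second system exceeds the first. -/
def excess (z : State V × State V) : ℝ := ∑ v, ((z.2 v - z.1 v : ℕ) : ℝ)

/-- `b ^ i` at a server where the first system has `i` tasks and the second one has more. -/
def gapWeight (b : ℝ) (z : State V × State V) (v : V) : ℝ :=
  if z.1 v < z.2 v then b ^ z.1 v else 0

/-- The Lyapunov function of the coupling. -/
def gapFunction (b : ℝ) (z : State V × State V) : ℝ := excess z - b * ∑ v, gapWeight b z v

lemma gapWeight_nonneg {b : ℝ} (hb : 0 ≤ b) (z : State V × State V) (v : V) :
    0 ≤ gapWeight b z v := by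
  unfold gapWeight; split_ifs <;> positivity

lemma excess_nonneg (z : State V × State V) : 0 ≤ excess z :=
  sum_nonneg fun _ _ => Nat.cast_nonneg _

lemma gapFunction_le_excess {b : ℝ} (hb : 0 ≤ b) (z : State V × State V) :
    gapFunction b z ≤ excess z :=
  sub_le_self _ (mul_nonneg hb (sum_nonneg fun v _ => gapWeight_nonneg hb z v))

/-- A server with positive weight has at least one surplus task, while its bonus is at most `b ≤ 1 /
2`. -/
lemma excess_le_two_mul_gapFunction {b : ℝ} (hb : 0 ≤ b) (hb2 : b ≤ 1 / 2)
    (z : State V × State V) : excess z ≤ 2 * gapFunction b z := by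
  have h : b * ∑ v, gapWeight b z v ≤ 1 / 2 * excess z := by
    rw [excess, mul_sum, mul_sum]
    refine sum_le_sum fun v _ => ?_
    unfold gapWeight
    split_ifs with hv
    · have h1 : (1 : ℝ) ≤ ((z.2 v - z.1 v : ℕ) : ℝ) := by
        exact_mod_cast Nat.sub_pos_of_lt hv
      have h2 : b ^ z.1 v ≤ 1 := pow_le_one₀ hb (by linarith)
      nlinarith [pow_nonneg hb (z.1 v)]
    · rw [mul_zero]; positivity
  unfold gapFunction
  linarith

lemma gapFunction_nonneg {b : ℝ} (hb : 0 ≤ b) (hb2 : b ≤ 1 / 2) (z : State V × State V) :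
    0 ≤ gapFunction b z := by
  have := excess_nonneg z
  have := excess_le_two_mul_gapFunction hb hb2 z
  linarith

lemma excess_eq_sub {z : State V × State V} (hz : ∀ v, z.1 v ≤ z.2 v) :
    excess z = ∑ v, (z.2 v : ℝ) - ∑ v, (z.1 v : ℝ) := by
  rw [excess, ← sum_sub_distrib]
  exact sum_congr rfl fun v _ => Nat.cast_sub (hz v)

/-- Departures yield `(1 - b)` per unit of gap weight, and arrivals cost at most `b * d * ρ`; the
equation for `b` makes the net gain exactly `1 / 2`. -/
lemma stepOp_gapFunction_le [Nonempty V] [Nonempty W] (hd : 0 < d)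
    (hE : ∀ w, (serversOf E w).Nonempty) {lam ρ b : ℝ} (hlam : 0 < lam)
    (hload : maxLoad E lam ≤ ρ) (hb0 : 0 < b) (hb : b * (1 + d * ρ) = 1 / 2)
    {z : State V × State V} (hz : ∀ v, z.1 v ≤ z.2 v) :
    stepOp pairStep (markLaw E d lam) (gapFunction b) z
      ≤ gapFunction b z - 1 / 2 * (∑ v, gapWeight b z v) / totalRate V lam := by
  obtain ⟨x, y⟩ := z
  simp only at hz
  have h := sum_markWeight_le (d := d) hE hlam hload
    (φ := fun ξ => gapFunction b (pairStep (x, y) ξ)) (c := gapFunction b (x, y))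
    (D := fun v => -((1 - b) * gapWeight b (x, y) v))
    (g := fun v => b * gapWeight b (x, y) v)
    (fun v => mul_nonneg hb0.le (gapWeight_nonneg hb0.le _ v)) univ ?_ ?_
  · refine h.trans_eq ?_
    rw [card_univ, Fintype.card_fin, sum_neg_distrib, ← mul_sum, ← mul_sum,
      sub_eq_add_neg (gapFunction b (x, y)), ← neg_div]
    congr 2
    linear_combination (∑ v, gapWeight b (x, y) v) * hb
  · intro a σ
    -- Each system accepts exactly one task.
    have he : excess (pairStep (x, y) (.inl (a, σ) : Mark E d)) = excess (x, y) := by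
      rw [excess_eq_sub (z := pairStep (x, y) (.inl (a, σ) : Mark E d)) (queueStep_mono hz (.inl (a, σ))), excess_eq_sub hz]
      simp only [pairStep]
      rw [sum_queueStep_arrival hd, sum_queueStep_arrival hd]
      ring
    have hs : ∑ j, b * gapWeight b (x, y) (a.2 j)
        = ∑ v, ∑ j, if (a.2 j : V) = v then b * gapWeight b (x, y) v else 0 := by
      rw [sum_comm]
      exact sum_congr rfl fun j _ => by rw [sum_ite_eq, if_pos (mem_univ _)]
    rw [hs, gapFunction, gapFunction, he, sub_add, sub_le_sub_iff_left, mul_sum, mul_sum,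
      ← sum_sub_distrib]
    refine sum_le_sum fun v _ => ?_
    have hnn : ∀ j, 0 ≤ if (a.2 j : V) = v then b * gapWeight b (x, y) v else 0 := fun j => by
      have := gapWeight_nonneg hb0.le (x, y) v
      split_ifs <;> positivity
    -- A weight changes only at a server that one of the systems joins. Such a server is in the
    -- sample, so the sum over sampled servers pays for the loss of its entire weight.
    by_cases hv : v ∈ joined x a.2 σ ∨ v ∈ joined y a.2 σ
    · have hv' : ∃ j, (a.2 j : V) = v := by
        rcases hv with hv | hv
        · exact (mem_shortest.mp (joined_subset hv)).1
        · exact (mem_shortest.mp (joined_subset hv)).1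
      obtain ⟨j, hj⟩ := hv'
      have h1 : b * gapWeight b (x, y) v
          ≤ ∑ j, if (a.2 j : V) = v then b * gapWeight b (x, y) v else 0 := by
        refine le_trans ?_ (single_le_sum (fun i _ => hnn i) (mem_univ j))
        rw [if_pos hj]
      have h2 := mul_nonneg hb0.le
        (gapWeight_nonneg hb0.le (pairStep (x, y) (.inl (a, σ) : Mark E d)) v)
      linarith
    · rw [not_or] at hv
      have h1 : gapWeight b (pairStep (x, y) (.inl (a, σ) : Mark E d)) v
          = gapWeight b (x, y) v := by
        simp [gapWeight, pairStep, queueStep, hv.1, hv.2]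
      rw [h1]
      exact sub_le_self _ (sum_nonneg fun j _ => hnn j)
  · intro v
    set z' : State V × State V := (Function.update x v (x v - 1), Function.update y v (y v - 1))
    have hz' : pairStep (x, y) (.inr v : Mark E d) = z' := rfl
    have h1 : ∀ u ∈ univ.erase v, ((z'.2 u - z'.1 u : ℕ) : ℝ) - b * gapWeight b z' u
        = ((y u - x u : ℕ) : ℝ) - b * gapWeight b (x, y) u := by
      intro u hu
      simp [z', gapWeight, Function.update_of_ne (ne_of_mem_erase hu)]
    have hG : ∀ z : State V × State V, gapFunction b z
        = ∑ v, (((z.2 v - z.1 v : ℕ) : ℝ) - b * gapWeight b z v) := fun z => by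
      rw [gapFunction, excess, mul_sum, sum_sub_distrib]
    rw [hz', hG, hG, ← add_sum_erase univ _ (mem_univ v), sum_congr rfl h1,
      ← add_sum_erase univ (fun u => (((y u - x u : ℕ) : ℝ) - b * gapWeight b (x, y) u))
        (mem_univ v)]
    -- If `x v = 0 < y v`, the excess falls by one. If `0 < x v < y v`, the excess is unchanged but
    -- the bonus grows from `b ^ (x v + 1)` to `b ^ (x v)`. Otherwise nothing changes.
    suffices hsuff : ((y v - 1 - (x v - 1) : ℕ) : ℝ) -
        b * (if x v - 1 < y v - 1 then b ^ (x v - 1) else 0)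
        ≤ ((y v - x v : ℕ) : ℝ) - b * (if x v < y v then b ^ x v else 0) -
          (1 - b) * (if x v < y v then b ^ x v else 0) by
      simp only [z', gapWeight, Function.update_self]
      linarith
    by_cases hxy : x v < y v
    · rcases Nat.eq_zero_or_pos (x v) with h0 | h0
      · obtain ⟨k, hk⟩ : ∃ k, y v = k + 1 := ⟨y v - 1, by omega⟩
        rw [h0, hk]
        simp only [Nat.add_sub_cancel, Nat.sub_zero, Nat.zero_sub, pow_zero, Nat.succ_pos, if_true]
        push_cast
        have : 0 ≤ b * (if 0 < k then 1 else 0) := by split_ifs <;> simp [hb0.le]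
        linarith
      · obtain ⟨k, hk⟩ : ∃ k, x v = k + 1 := ⟨x v - 1, by omega⟩
        have e : y v - 1 - (x v - 1) = y v - x v := by omega
        rw [if_pos hxy, if_pos (by omega), e, hk, Nat.add_sub_cancel, pow_succ]
        linarith
    · have e : y v - 1 - (x v - 1) = y v - x v := by omega
      rw [if_neg hxy, if_neg (by omega), e]
      linarith

/-- Interpolation between the gap weights and an exponential moment. -/
lemma excess_le_interpolation {b θ A : ℝ} {m : ℕ} (hb : 0 < b) (hθ : 1 ≤ θ)
    (hm : 2 / b ≤ θ ^ m) (hA : ∀ n : ℕ, (n : ℝ) ≤ A * θ ^ n) (hb1 : b ≤ 1) {ε : ℝ} (hε : 0 < ε)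
    (z : State V × State V) :
    ε ^ m * excess z ≤ ∑ v, gapWeight b z v + ε ^ m * (ε * (A * expSum (θ ^ 2) z.2)) := by
  rw [excess, expSum, mul_sum, mul_sum, mul_sum, mul_sum, ← sum_add_distrib]
  refine sum_le_sum fun v _ => ?_
  have hA0 : 0 ≤ A := by
    have := hA 0
    simpa using this
  have hεm : 0 < ε ^ m := pow_pos hε m
  have hyA : ((z.2 v - z.1 v : ℕ) : ℝ) ≤ A * θ ^ z.2 v :=
    le_trans (by exact_mod_cast Nat.sub_le _ _) (hA (z.2 v))
  have hθ0 : 0 < θ := by linarith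
  by_cases hxy : z.1 v < z.2 v
  · rw [gapWeight, if_pos hxy]
    -- Long queues, with `ε * θ ^ y ≥ 1`, are absorbed by the moment of base `θ ^ 2`. For the others
    -- `ε ^ m * θ ^ (m y) ≤ 1`, and the choice of `m` gives `y ≤ 2 ^ y ≤ b ^ y * θ ^ (m y)`, so the
    -- weight `b ^ x ≥ b ^ y` suffices.
    by_cases hc : 1 ≤ ε * θ ^ z.2 v
    · have h1 : A * θ ^ z.2 v ≤ ε * (A * (θ ^ 2) ^ z.2 v) := by
        rw [← pow_mul, mul_comm 2, pow_mul, pow_two]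
        have := mul_le_mul_of_nonneg_left hc (mul_nonneg hA0 (pow_nonneg hθ0.le (z.2 v)))
        linarith
      have := mul_le_mul_of_nonneg_left (hyA.trans h1) hεm.le
      have := pow_pos hb (z.1 v)
      linarith
    · have hc' : ε * θ ^ z.2 v ≤ 1 := (not_le.mp hc).le
      have h1 : ((z.2 v - z.1 v : ℕ) : ℝ) ≤ 2 ^ z.2 v := by
        exact_mod_cast (Nat.sub_le _ _).trans Nat.lt_two_pow_self.le
      have h2 : (2 : ℝ) ^ z.2 v ≤ b ^ z.2 v * (θ ^ z.2 v) ^ m := by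
        rw [← pow_mul, mul_comm (z.2 v), pow_mul, ← mul_pow]
        refine pow_le_pow_left₀ (by norm_num) ?_ _
        rwa [div_le_iff₀' hb] at hm
      have h3 : b ^ z.2 v ≤ b ^ z.1 v := pow_le_pow_of_le_one hb.le hb1 hxy.le
      have h4 : ε ^ m * (θ ^ z.2 v) ^ m ≤ 1 := by
        rw [← mul_pow]; exact pow_le_one₀ (by positivity) hc'
      have h5 : ε ^ m * ((z.2 v - z.1 v : ℕ) : ℝ) ≤ b ^ z.1 v := by
        calc ε ^ m * ((z.2 v - z.1 v : ℕ) : ℝ)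
            ≤ ε ^ m * (b ^ z.2 v * (θ ^ z.2 v) ^ m) :=
              mul_le_mul_of_nonneg_left (h1.trans h2) hεm.le
          _ = b ^ z.2 v * (ε ^ m * (θ ^ z.2 v) ^ m) := by ring
          _ ≤ b ^ z.2 v * 1 := mul_le_mul_of_nonneg_left h4 (by positivity)
          _ ≤ b ^ z.1 v := by rw [mul_one]; exact h3
      have h6 : 0 ≤ ε ^ m * (ε * (A * (θ ^ 2) ^ z.2 v)) := by positivity
      linarith
  · rw [Nat.sub_eq_zero_of_le (not_lt.mp hxy), gapWeight, if_neg hxy]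
    simp only [Nat.cast_zero, mul_zero, zero_add]
    positivity

end Drift

/-! ### A Foster–Lyapunov bound under the stationary law. -/

section StationaryMoment

lemma hasSum_poissonWeight_mul_pow (r t a : ℝ) :
    HasSum (fun k => poissonWeight r t k * a ^ k) (Real.exp (-(r * (1 - a) * t))) := by
  have h := (hasSum_poissonWeight (r * a) t).mul_left (Real.exp (-(r * (1 - a) * t)))
  rw [mul_one] at h
  convert! h using 1
  funext k
  rw [poissonWeight, poissonWeight, ← mul_assoc, ← Real.exp_add, mul_right_comm r a t,
    mul_pow (r * t)]
  have : -(r * (1 - a) * t) + -(r * t * a) = -(r * t) := by ring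
  rw [this]
  ring

variable {S Ξ : Type} [MeasurableSpace Ξ] [Fintype Ξ] [DiscreteMeasurableSpace Ξ]
  [MeasurableSpace S] [Countable S] [DiscreteMeasurableSpace S]

/-- A Foster–Lyapunov bound for the stationary mean of a function. -/
lemma lintegral_stationary_le (r : ℝ) [hr : Fact (0 < r)] (ν : Measure Ξ)
    [IsProbabilityMeasure ν] (step : S → Ξ → S) (π : Measure S) [IsProbabilityMeasure π]
    (hπ : ∀ t : ℝ, 0 ≤ t →
      (π.prod (noiseMeasure r ν)).map (fun ω => flow step ω.1 t ω.2) = π)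
    {f : S → ℝ} (hf : ∀ z, 0 ≤ f z) {a C : ℝ} (ha : 0 ≤ a) (ha1 : a < 1) (hC : 0 ≤ C)
    (h : ∀ z, stepOp step ν f z ≤ a * f z + (1 - a) * C) :
    ∫⁻ z, ENNReal.ofReal (f z) ∂π ≤ ENNReal.ofReal C := by
  have hmeas : ∀ g : S → ℝ, Measurable fun z => ENNReal.ofReal (g z) := fun g =>
    Measurable.of_discrete
  -- The integral of `f` is not known to be finite, so stationarity is applied to the truncation
  -- `min f m`. As `t → ∞` the initial term vanishes by dominated convergence, and letting `m → ∞`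
  -- removes the truncation.
  have htrunc : ∀ m : ℕ, ∫⁻ z, ENNReal.ofReal (min (f z) m) ∂π ≤ ENNReal.ofReal C := by
    intro m
    have hg0 : ∀ z, 0 ≤ min (f z) (m : ℝ) := fun z => le_min (hf z) (Nat.cast_nonneg m)
    have hstep : ∀ t : ℝ, 0 ≤ t → ∫⁻ z, ENNReal.ofReal (min (f z) m) ∂π
        ≤ ∫⁻ z, ENNReal.ofReal (min (Real.exp (-(r * (1 - a) * t)) * f z + C) m) ∂π := by
      intro t ht
      conv_lhs => rw [← hπ t ht]
      have hfl := lintegral_flow r ν step π (X := id) measurable_id hg0 ht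
      simp only [id] at hfl
      rw [lintegral_map (hmeas _) (measurable_flow step t), hfl]
      simp_rw [← lintegral_const_mul _ (hmeas _)]
      rw [← lintegral_tsum fun k => ((hmeas _).const_mul _).aemeasurable]
      refine lintegral_mono fun z => ?_
      simp_rw [← ENNReal.ofReal_mul (poissonWeight_nonneg hr.out.le ht _)]
      have hm : ∀ k, ((stepOp step ν)^[k] fun z => min (f z) (m : ℝ)) z ≤ m := fun k =>
        stepOp_iterate_le_const ν step (fun z => min_le_right _ _) k z
      have h0 : ∀ k, 0 ≤ ((stepOp step ν)^[k] fun z => min (f z) (m : ℝ)) z := fun k =>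
        stepOp_iterate_nonneg step ν hg0 k z
      have hsum := summable_poissonWeight_mul hr.out.le ht h0 hm
      rw [← ENNReal.ofReal_tsum_of_nonneg
        (fun k => mul_nonneg (poissonWeight_nonneg hr.out.le ht k) (h0 k)) hsum]
      refine ENNReal.ofReal_le_ofReal (le_min ?_ ?_)
      · have hs2 := ((hasSum_poissonWeight_mul_pow r t a).mul_right (f z)).add
          ((hasSum_poissonWeight r t).mul_right C)
        rw [one_mul] at hs2
        rw [← hs2.tsum_eq]
        refine hsum.tsum_le_tsum (fun k => ?_) hs2.summable
        have h1 : ((stepOp step ν)^[k] fun z => min (f z) (m : ℝ)) z ≤ a ^ k * f z + C := by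
          refine (stepOp_iterate_mono ν step (fun z => min_le_left _ _) k z).trans
            ((stepOp_iterate_le_of_contraction ν step ha h k z).trans ?_)
          have := mul_nonneg (pow_nonneg ha k) hC
          linarith
        have h2 := mul_le_mul_of_nonneg_left h1 (poissonWeight_nonneg hr.out.le ht k)
        linarith
      · have hs2 := (hasSum_poissonWeight r t).mul_right (m : ℝ)
        rw [one_mul] at hs2
        exact hasSum_le (fun k => mul_le_mul_of_nonneg_left (hm k)
          (poissonWeight_nonneg hr.out.le ht k)) hsum.hasSum hs2
    have hlim : Tendsto (fun n : ℕ => ∫⁻ z, ENNReal.ofReal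
        (min (Real.exp (-(r * (1 - a) * n)) * f z + C) m) ∂π) atTop
        (𝓝 (∫⁻ z, ENNReal.ofReal (min (0 * f z + C) m) ∂π)) := by
      refine tendsto_lintegral_of_dominated_convergence (fun _ => ENNReal.ofReal m)
        (fun n => hmeas _) (fun n => ae_of_all _ fun z => ENNReal.ofReal_le_ofReal
          (min_le_right _ _)) (by simp) (ae_of_all _ fun z => ?_)
      refine ENNReal.tendsto_ofReal (Tendsto.min (Tendsto.add_const C
        (Tendsto.mul_const (f z) ?_)) tendsto_const_nhds)
      refine Real.tendsto_exp_neg_atTop_nhds_zero.comp ?_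
      exact tendsto_natCast_atTop_atTop.const_mul_atTop (mul_pos hr.out (by linarith))
    refine (ge_of_tendsto' hlim fun n => hstep n (Nat.cast_nonneg n)).trans ?_
    refine (lintegral_mono fun z => ENNReal.ofReal_le_ofReal (min_le_left _ _)).trans ?_
    simp
  have hmono := lintegral_tendsto_of_tendsto_of_monotone (μ := π)
    (f := fun (m : ℕ) z => ENNReal.ofReal (min (f z) m)) (F := fun z => ENNReal.ofReal (f z))
    (fun m => (hmeas _).aemeasurable)
    (ae_of_all _ fun z m n hmn => ENNReal.ofReal_le_ofReal
      (min_le_min le_rfl (Nat.cast_le.mpr hmn)))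
    (ae_of_all _ fun z => by
      obtain ⟨N, hN⟩ := exists_nat_ge (f z)
      refine tendsto_const_nhds.congr' ?_
      filter_upwards [eventually_ge_atTop N] with n hn
      rw [min_eq_left (hN.trans (Nat.cast_le.mpr hn))])
  exact le_of_tendsto' hmono htrunc

end StationaryMoment

/-! ### Stationarity and moment contraction for the queues. -/

section QueueStationary

variable {V W : Type} [Fintype V] [DecidableEq V] [Fintype W] [DecidableEq W]
  {E : Finset (V × W)} {d : ℕ}

lemma IsStationary.map_flow [Nonempty V] [Nonempty W] (hd : 0 < d)
    (hE : ∀ w, (serversOf E w).Nonempty) {lam : ℝ} (hlam : 0 < lam)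
    [Fact (0 < totalRate V lam)] {π : Measure (State V)} [IsProbabilityMeasure π]
    (hπ : IsStationary E d lam π) {t : ℝ} (ht : 0 ≤ t) :
    (π.prod (noiseMeasure (totalRate V lam) (markLaw E d lam))).map
      (fun ω => flow queueStep ω.1 t ω.2) = π := by
  have := isProbabilityMeasure_markLaw (d := d) hlam hE
  have hfm : Measurable fun ω : State V × (ℕ → ℝ × Mark E d) => flow queueStep ω.1 t ω.2 :=
    measurable_flow queueStep t
  refine Measure.ext_of_singleton fun y => ?_
  set f : State V → ℝ := ({y} : Set (State V)).indicator 1 with hf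
  have hf0 : ∀ z, 0 ≤ f z := Set.indicator_nonneg fun _ _ => zero_le_one
  have hf1 : ∀ z, f z ≤ 1 := Set.indicator_le_self' fun _ _ => zero_le_one
  have hmeas : ∀ g : State V → ℝ, Measurable fun z => ENNReal.ofReal (g z) := fun g =>
    Measurable.of_discrete
  have h1 : (π.prod (noiseMeasure (totalRate V lam) (markLaw E d lam))).map
      (fun ω => flow queueStep ω.1 t ω.2) {y} = ∫⁻ ω, ENNReal.ofReal (f (flow queueStep ω.1 t ω.2))
        ∂(π.prod (noiseMeasure (totalRate V lam) (markLaw E d lam))) := by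
    rw [← lintegral_map (hmeas f) hfm, ← lintegral_indicator_one (measurableSet_singleton y)]
    refine lintegral_congr fun z => ?_
    by_cases hz : z ∈ ({y} : Set (State V))
    · rw [hf, Set.indicator_of_mem hz, Set.indicator_of_mem hz]; simp
    · rw [hf, Set.indicator_of_notMem hz, Set.indicator_of_notMem hz]; simp
  have hr : 0 < totalRate V lam := Fact.out
  have hfl := lintegral_flow (totalRate V lam) (markLaw E d lam) queueStep π (X := id)
    measurable_id hf0 ht
  simp only [id] at hfl
  rw [h1, hfl]
  simp_rw [← lintegral_const_mul _ (hmeas _)]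
  rw [← lintegral_tsum fun k => ((hmeas _).const_mul _).aemeasurable]
  have h2 : ∀ x, ∑' k, ENNReal.ofReal (poissonWeight (totalRate V lam) t k) *
      ENNReal.ofReal (((stepOp queueStep (markLaw E d lam))^[k] f) x)
      = ENNReal.ofReal (transition E d lam t x y) := by
    intro x
    rw [transition_eq hd hE hlam, jumpTransition, ENNReal.ofReal_tsum_of_nonneg]
    · exact tsum_congr fun k => (ENNReal.ofReal_mul (poissonWeight_nonneg hr.le ht k)).symm
    · exact fun k => mul_nonneg (poissonWeight_nonneg hr.le ht k)
        (stepOp_iterate_nonneg _ _ hf0 _ _)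
    · exact summable_poissonWeight_mul hr.le ht
        (fun k => stepOp_iterate_nonneg _ _ hf0 k x) fun k => stepOp_iterate_le_const _ _ hf1 k x
  simp_rw [h2]
  have hnn : ∀ x, 0 ≤ transition E d lam t x y := fun x => by
    rw [transition_eq hd hE hlam]; exact jumpTransition_nonneg hr.le ht _ _ _ _
  have hs : HasSum (fun x => π.real {x} * transition E d lam t x y) (π.real {y}) :=
    hπ ⟨t, ht⟩ y
  rw [lintegral_countable', ← ofReal_measureReal (μ := π) (s := {y}), ← hs.tsum_eq,
    ENNReal.ofReal_tsum_of_nonneg (fun x => mul_nonneg measureReal_nonneg (hnn x)) hs.summable]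
  refine tsum_congr fun x => ?_
  rw [ENNReal.ofReal_mul measureReal_nonneg, ofReal_measureReal, mul_comm]

lemma stepOp_expSum_contraction [Nonempty V] [Nonempty W] (hd : 0 < d)
    (hE : ∀ w, (serversOf E w).Nonempty) {lam ρ θ : ℝ} (hlam : 0 < lam)
    (hload : maxLoad E lam ≤ ρ) (hθ : 1 < θ) (hc : 0 < (1 - 1 / θ) - ρ * (θ - 1)) (x : State V) :
    stepOp queueStep (markLaw E d lam) (expSum θ) x
      ≤ (1 - ((1 - 1 / θ) - ρ * (θ - 1)) / totalRate V lam) * expSum θ x +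
        (1 - (1 - ((1 - 1 / θ) - ρ * (θ - 1)) / totalRate V lam)) *
        ((1 - 1 / θ) / ((1 - 1 / θ) - ρ * (θ - 1)) * Fintype.card V) := by
  refine (stepOp_expSum_le hd hE hlam hload hθ x).trans_eq ?_
  have := (totalRate_pos (V := V) hlam).ne'
  set c := (1 - 1 / θ) - ρ * (θ - 1)
  have hc' := hc.ne'
  generalize (1 - 1 / θ) = B
  field_simp
  ring

end QueueStationary

/-! ### The monotone coupling and its decay. -/

section Coupling

lemma stepOp_iterate_linear {S Ξ : Type} [MeasurableSpace Ξ] [Fintype Ξ] (ν : Measure Ξ)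
    (step : S → Ξ → S) (f g : S → ℝ) (a c : ℝ) (k : ℕ) (z : S) :
    ((stepOp step ν)^[k] fun z => a * f z + c * g z) z
      = a * ((stepOp step ν)^[k] f) z + c * ((stepOp step ν)^[k] g) z := by
  induction k generalizing z with
  | zero => rfl
  | succ k ih =>
    simp only [Function.iterate_succ_apply']
    rw [stepOp, stepOp, stepOp, mul_sum, mul_sum, ← sum_add_distrib]
    refine sum_congr rfl fun ξ _ => ?_
    rw [ih]
    ring

lemma integral_tsum_le_of_lintegral {Ω : Type*} [MeasurableSpace Ω] {P : Measure Ω}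
    {a : ℕ → Ω → ℝ} (ha : ∀ i, Measurable (a i)) (h0 : ∀ i ω, 0 ≤ a i ω) {B : ℝ} (hB : 0 ≤ B)
    (h : ∫⁻ ω, ∑' i, ENNReal.ofReal (a i ω) ∂P ≤ ENNReal.ofReal B) :
    Summable (fun i => ∫ ω, a i ω ∂P) ∧ ∑' i, ∫ ω, a i ω ∂P ≤ B := by
  rw [lintegral_tsum fun i => (ha i).ennreal_ofReal.aemeasurable] at h
  have hne := ne_top_of_le_ne_top ENNReal.ofReal_ne_top h
  have h1 : ∀ i, ∫ ω, a i ω ∂P = (∫⁻ ω, ENNReal.ofReal (a i ω) ∂P).toReal := fun i =>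
    integral_eq_lintegral_of_nonneg_ae (ae_of_all _ (h0 i)) (ha i).aestronglyMeasurable
  simp_rw [h1]
  refine ⟨ENNReal.summable_toReal hne, ?_⟩
  rw [← ENNReal.tsum_toReal_eq (ENNReal.ne_top_of_tsum_ne_top hne)]
  exact ENNReal.toReal_le_of_le_ofReal hB h

variable {V W : Type} [Fintype V] [DecidableEq V] [Fintype W] [DecidableEq W]
  {E : Finset (V × W)} {d : ℕ}

lemma chain_mono (k : ℕ) {x y : State V} (h : ∀ v, x v ≤ y v) (η : ℕ → ℝ × Mark E d) (v : V) :
    chain queueStep k x η v ≤ chain queueStep k y η v := by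
  induction k generalizing x y η with
  | zero => exact h v
  | succ k ih => exact ih (queueStep_mono h _) _

lemma flow_mono {x y : State V} (h : ∀ v, x v ≤ y v) (t : ℝ) (η : ℕ → ℝ × Mark E d) (v : V) :
    flow queueStep x t η v ≤ flow queueStep y t η v := by
  unfold flow
  split_ifs
  · exact chain_mono _ h η v
  · exact h v

lemma chain_pairStep (k : ℕ) (z : State V × State V) (η : ℕ → ℝ × Mark E d) :
    chain pairStep k z η = (chain queueStep k z.1 η, chain queueStep k z.2 η) := by
  induction k generalizing z η with
  | zero => rfl
  | succ k ih => exact ih _ _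

lemma flow_pairStep (z : State V × State V) (t : ℝ) (η : ℕ → ℝ × Mark E d) :
    flow pairStep z t η = (flow queueStep z.1 t η, flow queueStep z.2 t η) := by
  unfold flow
  split_ifs
  · exact chain_pairStep _ z η
  · rfl

lemma stepOp_pairStep_iterate (ν : Measure (Mark E d)) (g : State V → ℝ) (k : ℕ)
    (z : State V × State V) :
    ((stepOp pairStep ν)^[k] fun z => g z.2) z = ((stepOp queueStep ν)^[k] g) z.2 := by
  induction k generalizing z with
  | zero => rfl
  | succ k ih =>
    simp only [Function.iterate_succ_apply']
    exact sum_congr rfl fun ξ _ => by rw [ih]; rfl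

-- The layer-cake formula: a queue of length `n` is counted once for each level `1, …, n`, whence
-- the shift `i + 1`.
omit [DecidableEq V] in
lemma hasSum_tailFrac (x : State V) :
    HasSum (fun i : ℕ => tailFrac x (i + 1)) ((∑ v, (x v : ℝ)) / Fintype.card V) := by
  have h1 : ∀ n : ℕ, HasSum (fun i : ℕ => if i + 1 ≤ n then (1 : ℝ) else 0) n := by
    intro n
    have h : HasSum (fun i : ℕ => if i + 1 ≤ n then (1 : ℝ) else 0) _ :=
      hasSum_sum_of_ne_finset_zero (s := range n) fun i hi => if_neg (by rw [mem_range] at hi; omega)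
    convert! h using 1
    rw [sum_congr rfl fun i hi => if_pos (Nat.succ_le_of_lt (mem_range.mp hi))]
    simp
  have h2 := (hasSum_sum fun (v : V) (_ : v ∈ univ) => h1 (x v)).div_const (Fintype.card V : ℝ)
  convert! h2 using 1
  funext i
  rw [tailFrac, ← sum_filter, sum_const, nsmul_one]

lemma tsum_abs_tailFrac_sub {x y : State V} (h : ∀ v, x v ≤ y v) :
    ∑' i : ℕ, ENNReal.ofReal |tailFrac y (i + 1) - tailFrac x (i + 1)|
      = ENNReal.ofReal (excess (x, y) / Fintype.card V) := by
  have hnn : ∀ i : ℕ, 0 ≤ tailFrac y (i + 1) - tailFrac x (i + 1) := by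
    intro i
    rw [tailFrac, tailFrac, ← sub_div]
    refine div_nonneg (sub_nonneg.mpr (Nat.cast_le.mpr (card_le_card fun v => ?_)))
      (Nat.cast_nonneg _)
    simp only [mem_filter, mem_univ, true_and]
    exact fun hv => hv.trans (h v)
  have hs := (hasSum_tailFrac y).sub (hasSum_tailFrac x)
  simp_rw [abs_of_nonneg (hnn _)]
  rw [← ENNReal.ofReal_tsum_of_nonneg hnn hs.summable, hs.tsum_eq, excess_eq_sub h, sub_div]

lemma isQueueProcess_flow [Nonempty V] [Nonempty W] (hd : 0 < d)
    (hE : ∀ w, (serversOf E w).Nonempty) {lam : ℝ} (hlam : 0 < lam)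
    [Fact (0 < totalRate V lam)] {Ω : Type} [MeasurableSpace Ω] {P : Measure Ω} {X : Ω → State V}
    (hX : Measurable X) :
    IsQueueProcess E d lam (P.map X)
      (P.prod (noiseMeasure (totalRate V lam) (markLaw E d lam)))
      fun t ω => flow queueStep (X ω.1) t ω.2 := by
  have := isProbabilityMeasure_markLaw (d := d) hlam hE
  refine ⟨fun t => (measurable_flow queueStep t).comp
    ((hX.comp measurable_fst).prodMk measurable_snd), ae_cadlag_flow _ _ queueStep P X, ?_⟩
  intro n t x ht h0
  rw [measureReal_flow (totalRate V lam) (markLaw E d lam) queueStep P hX n (fun i => (t i : ℝ)) x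
    (fun i j hij => NNReal.coe_le_coe.mpr (ht hij)) (by rw [h0]; rfl)]
  congr 1
  exact prod_congr rfl fun i _ => (transition_eq hd hE hlam _ _ _).symm

/-- The decay of the Lyapunov function along the embedded chain of the coupling. -/
lemma stepOp_gapFunction_iterate_le [Nonempty V] [Nonempty W] (hd : 0 < d)
    (hE : ∀ w, (serversOf E w).Nonempty) {lam ρ b θ A : ℝ} {m : ℕ} (hlam : 0 < lam)
    (hload : maxLoad E lam ≤ ρ) (hb0 : 0 < b) (hb : b * (1 + d * ρ) = 1 / 2) (hb1 : b ≤ 1)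
    (hθ : 1 ≤ θ) (hm : 2 / b ≤ θ ^ m) (hA : ∀ n : ℕ, (n : ℝ) ≤ A * θ ^ n) {ε : ℝ} (hε : 0 < ε)
    (n : ℕ) {z : State V × State V} (hz : ∀ v, z.1 v ≤ z.2 v) :
    ((stepOp pairStep (markLaw E d lam))^[n + 1] (gapFunction b)) z
      ≤ (1 - 1 / 2 * ε ^ m / totalRate V lam) *
          ((stepOp pairStep (markLaw E d lam))^[n] (gapFunction b)) z
        + 1 / 2 * ε ^ m / totalRate V lam * (ε * A) *
          ((stepOp queueStep (markLaw E d lam))^[n] (expSum (θ ^ 2))) z.2 := by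
  have hR := totalRate_pos (V := V) hlam
  rw [Function.iterate_succ_apply, ← stepOp_pairStep_iterate, ← stepOp_iterate_linear]
  refine stepOp_iterate_mono_on (markLaw E d lam) pairStep (p := fun z => ∀ v, z.1 v ≤ z.2 v)
    (fun z ξ h => queueStep_mono h ξ) (fun z hz => ?_) n hz
  -- Interpolation bounds the sum of the gap weights from below by `ε ^ m` times the Lyapunov
  -- function, up to a moment of the larger system.
  refine (stepOp_gapFunction_le hd hE hlam hload hb0 hb hz).trans ?_
  have h1 := excess_le_interpolation hb0 hθ hm hA hb1 hε z
  have h2 := mul_le_mul_of_nonneg_left (gapFunction_le_excess hb0.le z) (pow_pos hε m).le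
  have h3 := mul_le_mul_of_nonneg_left (h2.trans h1)
    (show 0 ≤ 1 / 2 / totalRate V lam by positivity)
  have e1 : 1 / 2 * ε ^ m / totalRate V lam * (ε * A) * expSum (θ ^ 2) z.2
      = 1 / 2 / totalRate V lam * (ε ^ m * (ε * (A * expSum (θ ^ 2) z.2))) := by ring
  have e2 : (1 - 1 / 2 * ε ^ m / totalRate V lam) * gapFunction b z
      = gapFunction b z - 1 / 2 / totalRate V lam * (ε ^ m * gapFunction b z) := by ring
  have e3 : 1 / 2 * (∑ v, gapWeight b z v) / totalRate V lam
      = 1 / 2 / totalRate V lam * ∑ v, gapWeight b z v := by ring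
  rw [e1, e2, e3]
  linarith

/-- The polynomial decay of the mean excess of the coupling, with constants that depend only on the
load and on the number of sampled servers. -/
lemma lintegral_excess_le [Nonempty V] [Nonempty W] (hd : 0 < d)
    (hE : ∀ w, (serversOf E w).Nonempty) {lam ρ b θ A C : ℝ} {m : ℕ} (hlam : 0 < lam)
    (hload : maxLoad E lam ≤ ρ) (hρ : 0 ≤ ρ) (hb0 : 0 < b) (hb : b * (1 + d * ρ) = 1 / 2)
    (hb2 : b ≤ 1 / 2)
    (hθ : 1 < θ) (hm0 : 0 < m) (hm : 2 / b ≤ θ ^ m) (hA : ∀ n : ℕ, (n : ℝ) ≤ A * θ ^ n)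
    (hc : 0 < (1 - 1 / θ ^ 2) - ρ * (θ ^ 2 - 1)) (hC1 : 1 ≤ C)
    (hC : 4 * A * ((1 - 1 / θ ^ 2) / ((1 - 1 / θ ^ 2) - ρ * (θ ^ 2 - 1))) ≤ C)
    [Fact (0 < totalRate V lam)] {Ω : Type} [MeasurableSpace Ω] {P : Measure Ω}
    [IsProbabilityMeasure P] {X Y : Ω → State V} (hX : Measurable X) (hY : Measurable Y)
    (hXY : ∀ᵐ ω ∂P, ∀ v, X ω v ≤ Y ω v) [IsProbabilityMeasure (P.map Y)]
    (hπ : IsStationary E d lam (P.map Y)) {t : ℝ} (ht : 0 ≤ t) :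
    ∫⁻ ω, ENNReal.ofReal (excess (flow queueStep (X ω.1) t ω.2, flow queueStep (Y ω.1) t ω.2) /
        Fintype.card V) ∂(P.prod (noiseMeasure (totalRate V lam) (markLaw E d lam)))
      ≤ ENNReal.ofReal (1 / ((C ^ m)⁻¹ + m / (8 * (2 * C) ^ m) * t) ^ (1 / (m : ℝ))) := by
  have := isProbabilityMeasure_markLaw (d := d) hlam hE
  set r := totalRate V lam with hr
  have hr0 : 0 < r := Fact.out
  set ν := markLaw E d lam
  have hN : 1 ≤ (Fintype.card V : ℝ) := by exact_mod_cast Fintype.card_pos (α := V)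
  -- Together with `c ≤ B ≤ 1` this keeps the contraction factor `1 - c / r` nonnegative.
  have hr1 : 1 ≤ r := by
    rw [hr, totalRate]; nlinarith
  set B : ℝ := 1 - 1 / θ ^ 2 with hBdef
  set c : ℝ := B - ρ * (θ ^ 2 - 1) with hcdef
  have hθ2 : 1 < θ ^ 2 := one_lt_pow₀ hθ two_ne_zero
  have hB0 : 0 ≤ B := by
    rw [hBdef, sub_nonneg, div_le_one (by linarith)]; exact hθ2.le
  have hB1 : B ≤ 1 := by
    rw [hBdef]; have : 0 ≤ 1 / θ ^ 2 := by positivity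
    linarith
  have hcr : c / r ≤ 1 := by
    rw [div_le_one hr0]
    have : 0 ≤ ρ * (θ ^ 2 - 1) := mul_nonneg hρ (by linarith)
    linarith
  have hcr0 : 0 < c / r := div_pos hc hr0
  set H : State V → ℝ := expSum (θ ^ 2) with hHdef
  have hH0 : ∀ x, 0 ≤ H x := fun x => sum_nonneg fun v _ => by positivity
  set M : ℝ := B / c * Fintype.card V with hM
  have hM0 : 0 ≤ M := by positivity
  have hcontr : ∀ x, stepOp queueStep ν H x ≤ (1 - c / r) * H x + (1 - (1 - c / r)) * M :=
    stepOp_expSum_contraction hd hE hlam hload hθ2 hc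
  have hA0 : 0 ≤ A := by simpa using hA 0
  -- the stationary moment
  have hmom := lintegral_stationary_le r ν queueStep (P.map Y)
    (fun t ht => hπ.map_flow hd hE hlam ht) hH0 (a := 1 - c / r) (by linarith) (by linarith) hM0
    hcontr
  have hHm : Measurable fun x => ENNReal.ofReal (H x) := Measurable.of_discrete
  rw [lintegral_map hHm hY] at hmom
  have hmeas : ∀ f : State V × State V → ℝ, Measurable fun ω => f (X ω, Y ω) := fun f =>
    (Measurable.of_discrete (f := f)).comp (hX.prodMk hY)
  have hHY : Measurable fun ω => H (Y ω) := (Measurable.of_discrete (f := H)).comp hY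
  have hHint : Integrable (fun ω => H (Y ω)) P := by
    refine ⟨hHY.aestronglyMeasurable, ?_⟩
    rw [hasFiniteIntegral_iff_ofReal (ae_of_all _ fun ω => hH0 _)]
    exact hmom.trans_lt ENNReal.ofReal_lt_top
  have hHle : ∫ ω, H (Y ω) ∂P ≤ M := by
    rw [integral_eq_lintegral_of_nonneg_ae (ae_of_all _ fun ω => hH0 _) hHY.aestronglyMeasurable]
    exact ENNReal.toReal_le_of_le_ofReal hM0 hmom
  set KH : ℕ → Ω → ℝ := fun n ω => ((stepOp queueStep ν)^[n] H) (Y ω) with hKH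
  have hKHle : ∀ n ω, KH n ω ≤ H (Y ω) + M := by
    intro n ω
    refine (stepOp_iterate_le_of_contraction ν queueStep (by linarith) hcontr n (Y ω)).trans ?_
    have h1 : (1 - c / r) ^ n ≤ 1 := pow_le_one₀ (by linarith) (by linarith)
    have h2 : 0 ≤ (1 - c / r) ^ n := pow_nonneg (by linarith) n
    have h3 := mul_le_mul_of_nonneg_right h1 (hH0 (Y ω))
    have h4 := mul_nonneg h2 hM0
    linarith
  have hKH0 : ∀ n ω, 0 ≤ KH n ω := fun n ω => stepOp_iterate_nonneg _ _ hH0 n _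
  have hKHint : ∀ n, Integrable (KH n) P := fun n =>
    (hHint.add (integrable_const M)).mono'
      ((Measurable.of_discrete (f := (stepOp queueStep ν)^[n] H)).comp hY).aestronglyMeasurable
      (ae_of_all _ fun ω => by
        rw [Real.norm_of_nonneg (hKH0 n ω)]; exact hKHle n ω)
  -- One `M` bounds the stationary mean, the other is the additive constant of the contraction.
  have hKHM : ∀ n, ∫ ω, KH n ω ∂P ≤ 2 * M := by
    intro n
    refine (integral_mono (hKHint n) (hHint.add (integrable_const M)) (hKHle n)).trans ?_
    simp only [Pi.add_apply]
    rw [integral_add hHint (integrable_const M)]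
    simp only [integral_const, probReal_univ, one_smul]
    linarith
  -- the Lyapunov function
  set F : State V × State V → ℝ := gapFunction b with hFdef
  have hF0 : ∀ z, 0 ≤ F z := gapFunction_nonneg hb0.le hb2
  -- The zero term only brings the bound into the form required by `stepOp_iterate_linear`.
  have hFH : ∀ z, F z ≤ A * H z.2 + 0 * H z.2 := by
    intro z
    refine (gapFunction_le_excess hb0.le z).trans ?_
    rw [zero_mul, add_zero, excess, hHdef, expSum, mul_sum]
    refine sum_le_sum fun v _ => ?_
    refine le_trans (Nat.cast_le.mpr (Nat.sub_le _ _)) ((hA (z.2 v)).trans ?_)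
    refine mul_le_mul_of_nonneg_left ?_ hA0
    exact pow_le_pow_left₀ (by linarith) (by nlinarith) _
  set KF : ℕ → Ω → ℝ := fun n ω => ((stepOp pairStep ν)^[n] F) (X ω, Y ω) with hKF
  have hKF0 : ∀ n ω, 0 ≤ KF n ω := fun n ω => stepOp_iterate_nonneg _ _ hF0 n _
  have hKFle : ∀ n ω, KF n ω ≤ A * KH n ω := by
    intro n ω
    have h1 := stepOp_iterate_mono ν pairStep hFH n (X ω, Y ω)
    rw [stepOp_iterate_linear ν pairStep (fun z => H z.2) (fun z => H z.2) A 0 n,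
      stepOp_pairStep_iterate, zero_mul, add_zero] at h1
    exact h1
  have hKFint : ∀ n, Integrable (KF n) P := fun n =>
    ((hKHint n).const_mul A).mono' (hmeas _).aestronglyMeasurable
      (ae_of_all _ fun ω => by rw [Real.norm_of_nonneg (hKF0 n ω)]; exact hKFle n ω)
  set e : ℕ → ℝ := fun n => ∫ ω, KF n ω ∂P with he
  have he0 : ∀ n, 0 ≤ e n := fun n => integral_nonneg (hKF0 n)
  -- The factor `2` comes from `excess_le_two_mul_gapFunction`. Division by `N` cancels the `N` in
  -- `M`, so that `C` does not depend on the graph.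
  set u : ℕ → ℝ := fun n => 2 / Fintype.card V * e n with hu
  have hN0 : 0 < (Fintype.card V : ℝ) := by linarith
  have hMC : 2 / Fintype.card V * (A * (2 * M)) ≤ C := by
    refine le_trans (le_of_eq ?_) hC
    rw [hM]; field_simp; ring
  have hu0 : ∀ n, 0 ≤ u n := fun n => mul_nonneg (by positivity) (he0 n)
  have huC : ∀ n, u n ≤ C := by
    intro n
    refine le_trans (mul_le_mul_of_nonneg_left ?_ (by positivity)) hMC
    refine (integral_mono (hKFint n) ((hKHint n).const_mul A) (hKFle n)).trans ?_
    rw [integral_const_mul]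
    exact mul_le_mul_of_nonneg_left (hKHM n) hA0
  have hrec : ∀ n, ∀ ε : ℝ, 0 < ε → ε ≤ 1 →
      r * (u (n + 1) - u n) ≤ -(1 / 2 * ε ^ m * (u n - ε * C)) := by
    intro n ε hε hε1
    set q : ℝ := 1 / 2 * ε ^ m / r with hq
    have hq0 : 0 ≤ q := by positivity
    have h1 : e (n + 1) ≤ (1 - q) * e n + q * (ε * A) * ∫ ω, KH n ω ∂P := by
      rw [he]
      simp only
      rw [← integral_const_mul, ← integral_const_mul, ← integral_add ((hKFint n).const_mul _)
        ((hKHint n).const_mul _)]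
      refine integral_mono_ae (hKFint (n + 1)) (((hKFint n).const_mul _).add
        ((hKHint n).const_mul _)) (hXY.mono fun ω hω => ?_)
      exact stepOp_gapFunction_iterate_le hd hE hlam hload hb0 hb (by linarith) hθ.le hm hA hε n hω
    have h2 : e (n + 1) ≤ (1 - q) * e n + q * (ε * A) * (2 * M) :=
      h1.trans (add_le_add le_rfl (mul_le_mul_of_nonneg_left (hKHM n) (by positivity)))
    have h3 : u (n + 1) ≤ (1 - q) * u n + q * ε * C := by
      have h4 := mul_le_mul_of_nonneg_left h2 (show 0 ≤ 2 / (Fintype.card V : ℝ) by positivity)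
      have h5 := mul_le_mul_of_nonneg_left hMC (mul_nonneg hq0 hε.le)
      simp only [hu]
      linarith
    have h6 : u (n + 1) - u n ≤ -(q * (u n - ε * C)) := by linarith
    have h7 := mul_le_mul_of_nonneg_left h6 hr0.le
    have h8 : r * -(q * (u n - ε * C)) = -(1 / 2 * ε ^ m * (u n - ε * C)) := by
      rw [hq]; field_simp
    linarith
  have hfinal := poissonMixture_le hm0 hC1 hr0 hu0 huC hrec ht
  refine le_trans ?_ (ENNReal.ofReal_le_ofReal hfinal)
  have hfl := lintegral_flow r ν pairStep P (hX.prodMk hY) hF0 ht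
  have hei : ∀ n, ∫⁻ ω, ENNReal.ofReal (KF n ω) ∂P = ENNReal.ofReal (e n) := fun n =>
    (ofReal_integral_eq_lintegral_ofReal (hKFint n) (ae_of_all _ (hKF0 n))).symm
  have hw0 : ∀ n, 0 ≤ poissonWeight r t n := poissonWeight_nonneg hr0.le ht
  calc ∫⁻ ω, ENNReal.ofReal (excess (flow queueStep (X ω.1) t ω.2, flow queueStep (Y ω.1) t ω.2) /
        Fintype.card V) ∂(P.prod (noiseMeasure r ν))
      ≤ ∫⁻ ω, ENNReal.ofReal (2 / Fintype.card V) *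
          ENNReal.ofReal (F (flow pairStep (X ω.1, Y ω.1) t ω.2)) ∂(P.prod (noiseMeasure r ν)) := by
        refine lintegral_mono fun ω => ?_
        rw [flow_pairStep, ← ENNReal.ofReal_mul (by positivity)]
        refine ENNReal.ofReal_le_ofReal ?_
        rw [div_mul_eq_mul_div]
        exact div_le_div_of_nonneg_right (excess_le_two_mul_gapFunction hb0.le hb2 _) hN0.le
    _ = ENNReal.ofReal (2 / Fintype.card V) *
          ∑' n, ENNReal.ofReal (poissonWeight r t n) * ENNReal.ofReal (e n) := by
        rw [lintegral_const_mul' _ _ ENNReal.ofReal_ne_top, hfl]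
        congr 1
        exact tsum_congr fun n => by rw [← hei]
    _ = ENNReal.ofReal (∑' n, poissonWeight r t n * u n) := by
        rw [ENNReal.ofReal_tsum_of_nonneg (fun n => mul_nonneg (hw0 n) (hu0 n))
          (summable_poissonWeight_mul hr0.le ht hu0 huC), ← ENNReal.tsum_mul_left]
        refine tsum_congr fun n => ?_
        rw [ENNReal.ofReal_mul (hw0 n), hu, ENNReal.ofReal_mul (by positivity)]
        ring
    _ ≤ _ := le_rfl

end Coupling

end JSQ

/-! ### Choice of the constants and conclusion. -/

theorem mainTheorem5 (ρ₀ : ℝ) (hρ₀ : ρ₀ < 1) (d : ℕ) (hd : 2 ≤ d) :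
    ∃ c₁ c₂ α : ℝ, 0 < c₁ ∧ 0 < c₂ ∧ 0 < α ∧ α ≤ 1 ∧
      ∀ (V W : Type) [Fintype V] [DecidableEq V] [Nonempty V]
        [Fintype W] [DecidableEq W] [Nonempty W]
        (E : Finset (V × W)) (lam : ℝ) (μ₀ π : Measure (JSQ.State V))
        [IsProbabilityMeasure μ₀] [IsProbabilityMeasure π],
        (∀ w, (JSQ.serversOf E w).Nonempty) →
        0 < lam →
        JSQ.maxLoad E lam ≤ ρ₀ →
        JSQ.IsStationary E d lam π →
        JSQ.StochLE μ₀ π →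
        ∃ (Ω : Type) (_ : MeasurableSpace Ω) (P : Measure Ω) (_ : IsProbabilityMeasure P)
          (X₁ X₂ : ℝ≥0 → Ω → JSQ.State V),
          JSQ.IsQueueProcess E d lam μ₀ P X₁ ∧
          JSQ.IsQueueProcess E d lam π P X₂ ∧
          ∀ t : ℝ≥0,
            Summable (fun i : ℕ =>
              ∫ ω, |JSQ.tailFrac (X₂ t ω) (i + 1) - JSQ.tailFrac (X₁ t ω) (i + 1)| ∂P) ∧
            ∑' i : ℕ,
              ∫ ω, |JSQ.tailFrac (X₂ t ω) (i + 1) - JSQ.tailFrac (X₁ t ω) (i + 1)| ∂P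
                ≤ 1 / (c₁ + c₂ * (t : ℝ)) ^ α := by
  have hd0 : 0 < d := by omega
  -- A positive load bound is needed in order to invert `ρ`, and `ρ₀` need not be positive.
  obtain ⟨ρ, hρ, hρ1, hρ0⟩ : ∃ ρ, ρ₀ ≤ ρ ∧ ρ < 1 ∧ 0 < ρ :=
    ⟨max ρ₀ (1 / 2), le_max_left _ _, max_lt hρ₀ (by norm_num), lt_max_of_lt_right (by norm_num)⟩
  obtain ⟨θ, hθ, hρθ⟩ : ∃ θ : ℝ, 1 < θ ∧ ρ * θ ^ 2 < 1 := by
    -- `θ ^ 2` is the midpoint of `1` and `1 / ρ`, so the moment of base `θ ^ 2` still has negative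
    -- drift.
    refine ⟨√((ρ⁻¹ + 1) / 2), ?_, ?_⟩
    · rw [Real.lt_sqrt zero_le_one]
      have := one_lt_inv₀ hρ0 |>.mpr hρ1
      linarith
    · rw [Real.sq_sqrt (by positivity)]
      have := mul_inv_cancel₀ hρ0.ne'
      linarith
  have hθ2 : 1 < θ ^ 2 := one_lt_pow₀ hθ two_ne_zero
  have hc : 0 < (1 - 1 / θ ^ 2) - ρ * (θ ^ 2 - 1) := by
    have e : (1 - 1 / θ ^ 2) - ρ * (θ ^ 2 - 1) = (θ ^ 2 - 1) * (1 - ρ * θ ^ 2) / θ ^ 2 := by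
      field_simp
    rw [e]
    exact div_pos (mul_pos (by linarith) (by linarith)) (by linarith)
  set A : ℝ := 1 / (θ - 1)
  have hA : ∀ n : ℕ, (n : ℝ) ≤ A * θ ^ n := by
    intro n
    -- Bernoulli's inequality gives `n (θ - 1) ≤ θ ^ n`.
    have h := one_add_mul_le_pow (a := θ - 1) (by linarith) n
    rw [add_sub_cancel] at h
    rw [one_div_mul_eq_div, le_div_iff₀ (by linarith)]
    linarith
  set b : ℝ := 1 / (2 * (1 + d * ρ))
  have hdρ : 0 ≤ d * ρ := by positivity
  have hb0 : 0 < b := by positivity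
  have hb : b * (1 + d * ρ) = 1 / 2 := by
    simp only [b]; field_simp
  have hb2 : b ≤ 1 / 2 := by
    rw [← hb]; exact le_mul_of_one_le_right hb0.le (by linarith)
  -- This `m` fixes the exponent `α = 1 / m`; it is positive because `2 / b > 1`.
  obtain ⟨m, hm⟩ := pow_unbounded_of_one_lt (2 / b) hθ
  have hm0 : 0 < m := by
    rcases Nat.eq_zero_or_pos m with h | h
    · rw [h, pow_zero, div_lt_one hb0] at hm; linarith
    · exact h
  set C : ℝ := max 1 (4 * A * ((1 - 1 / θ ^ 2) / ((1 - 1 / θ ^ 2) - ρ * (θ ^ 2 - 1))))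
  have hC1 : 1 ≤ C := le_max_left _ _
  have hC0 : 0 < C := by linarith
  have hm1 : (1 : ℝ) ≤ m := by exact_mod_cast hm0
  refine ⟨(C ^ m)⁻¹, m / (8 * (2 * C) ^ m), 1 / (m : ℝ), by positivity, by positivity,
    by positivity, by rw [div_le_one (by linarith)]; exact hm1, ?_⟩
  intro V W _ _ _ _ _ _ E lam μ₀ π _ _ hE hlam hload hπ hst
  obtain ⟨Ω, _, P, _, X, Y, hX, hY, rfl, rfl, hXY⟩ := hst
  have : Fact (0 < JSQ.totalRate V lam) := ⟨JSQ.totalRate_pos hlam⟩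
  have := JSQ.isProbabilityMeasure_markLaw (d := d) hlam hE
  refine ⟨Ω × (ℕ → ℝ × JSQ.Mark E d), inferInstance,
    P.prod (JSQ.noiseMeasure (JSQ.totalRate V lam) (JSQ.markLaw E d lam)), inferInstance,
    fun t ω => JSQ.flow JSQ.queueStep (X ω.1) t ω.2,
    fun t ω => JSQ.flow JSQ.queueStep (Y ω.1) t ω.2,
    JSQ.isQueueProcess_flow hd0 hE hlam hX, JSQ.isQueueProcess_flow hd0 hE hlam hY, fun t => ?_⟩
  have hmX : Measurable fun ω : Ω × (ℕ → ℝ × JSQ.Mark E d) =>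
      JSQ.flow JSQ.queueStep (X ω.1) t ω.2 :=
    (JSQ.measurable_flow JSQ.queueStep t).comp ((hX.comp measurable_fst).prodMk measurable_snd)
  have hmY : Measurable fun ω : Ω × (ℕ → ℝ × JSQ.Mark E d) =>
      JSQ.flow JSQ.queueStep (Y ω.1) t ω.2 :=
    (JSQ.measurable_flow JSQ.queueStep t).comp ((hY.comp measurable_fst).prodMk measurable_snd)
  refine JSQ.integral_tsum_le_of_lintegral (fun i => ?_) (fun i ω => abs_nonneg _)
    (by positivity) ?_
  · have hT : Measurable fun x : JSQ.State V => JSQ.tailFrac x (i + 1) := Measurable.of_discrete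
    exact ((hT.comp hmY).sub (hT.comp hmX)).abs
  · refine le_trans (le_of_eq ?_) (JSQ.lintegral_excess_le hd0 hE hlam (hload.trans hρ) hρ0.le hb0
      hb hb2 hθ hm0 hm.le hA hc hC1 (le_max_right _ _) hX hY hXY hπ t.coe_nonneg)
    refine lintegral_congr_ae ?_
    filter_upwards [Measure.quasiMeasurePreserving_fst.ae hXY] with ω hω
    exact JSQ.tsum_abs_tailFrac_sub (JSQ.flow_mono hω t ω.2)
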